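/- Let $n\in\mathbb N$, let $X_0,X_1$ be complex Banach spaces, $X:=\mathcal L(X_0,X_1)$, $\tau>0$ and $m\in\mathbb R$. Let $C^\tau(\mathbb R^n;X)$ be the H\"older space of functions with continuous bounded partial derivatives up to order $[\tau]$ whose norm $$\|f\|_{C^\tau(\mathbb R^n;X)}=\sum_{|\beta|\le[\tau]}\sup_{x}\|\partial^\beta f(x)\|+\sum_{|\beta|=[\tau]}\sup_{x\ne y}\frac{\|\partial^\beta f(x)-\partial^\beta f(y)\|}{|x-y|^{\tau-[\tau]}}$$ is finite. Let $p\in C^\tau S^m_{1,0}(\mathbb R^n\times\mathbb R^n;X)$, i.e. $p:\mathbb R^n\times\mathbb R^n\to X$ is such that $p(x,\xi)$ is smooth in $\xi$, is $C^\tau$ in $x$ together with all its $\xi$-derivatives, and for every multi-index $\alpha$ there is $C_\alpha$ with $\|\partial_\xi^\alpha p(\cdot,\xi)\|_{C^\tau(\mathbb R^n;X)}\le C_\alpha(1+|\xi|^2)^{(m-|\alpha|)/2}$ for all $\xi\in\mathbb R^n$. For $u\in\mathcal S(\mathbb R^n;X_0)$ put $$p(x,D_x)u(x)=(2\pi)^{-n}\int_{\mathbb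 R^n}e^{ix\cdot\xi}p(x,\xi)\widehat u(\xi)\,d\xi,\qquad \widehat u(\xi)=\int_{\mathbb R^n}e^{-iy\cdot\xi}u(y)\,dy.$$ Let $\varphi,\psi:\mathbb R^n\to\mathbb C$ be smooth functions that are bounded together with all their derivatives and satisfy $\operatorname{supp}\varphi\cap\operatorname{supp}\psi=\emptyset$. Then the operator $\varphi(x)p(x,D_x)\psi(x)$ has a $C^\tau$--$C^\infty$ kernel: there is $K:\mathbb R^n\times\mathbb R^n\to X$ such that (i) $\varphi(x)\,\big(p(x,D_x)(\psi f)\big)(x)=\int_{\mathbb R^n}K(x,x-y)f(y)\,dy$ for all $f\in\mathcal S(\mathbb R^n;X_0)$ and all $x\in\mathbb R^n$; (ii) $K(x,z)$ is smooth in $z$ for every $x$, and for all multi-indices $\alpha,\beta$ and all $z$ the function $x\mapsto z^\beta\partial_z^\alpha K(x,z)$ belongs to $C^\tau(\mathbb R^n;X)$, with $$\sup_{z\in\mathbb R^n}\big\|z^\beta\partial_z^\alpha K(\cdot,z)\big\|_{C^\tau(\mathbb R^n;X)}<\infty.$$ -/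

import Mathlib

open scoped ContDiff SchwartzMap ENNReal

namespace NonsmoothPDO

noncomputable section

/-- The Euclidean space `ℝⁿ`. -/
abbrev Rn (n : ℕ) : Type := EuclideanSpace ℝ (Fin n)

/-- The length `|α| = α₁ + ⋯ + αₙ` of a multi-index `α`. -/
def multiLength {n : ℕ} (α : Fin n → ℕ) : ℕ := ∑ i, α i

/-- The partial derivative `∂^α f (x) = ∂₁^{α₁} ⋯ ∂ₙ^{αₙ} f (x)`, that is, the `|α|`-th derivative
of `f` at `x` applied to `e₁` (`α₁` times), ..., `eₙ` (`αₙ` times). It is only used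
for functions that are `|α|` times continuously differentiable. -/
def partialDeriv {n : ℕ} {F : Type*} [NormedAddCommGroup F] [NormedSpace ℝ F]
    (α : Fin n → ℕ) (f : Rn n → F) (x : Rn n) : F :=
  iteratedFDeriv ℝ (∑ i, α i) f x
    (fun j => EuclideanSpace.single (finSigmaFinEquiv.symm j).1 (1 : ℝ))

/-- The monomial `z^β`. -/
def monomialPow {n : ℕ} (β : Fin n → ℕ) (z : Rn n) : ℝ := ∏ i, z i ^ β i

/-- The Hölder norm of degree `τ`, with values in `[0, ∞]`:
the sum over `|β| ≤ [τ]` of the sup norms of `∂^β f` plus the sum over `|β| = [τ]` of the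
`(τ - [τ])`-Hölder seminorms of `∂^β f`. For functions in `C^{[τ]}` the supremum and the essential
supremum of `∂^β f` agree. -/
def ctauNorm {n : ℕ} {F : Type*} [NormedAddCommGroup F] [NormedSpace ℝ F]
    (τ : ℝ) (f : Rn n → F) : ℝ≥0∞ :=
  (∑ j ∈ Finset.range (⌊τ⌋₊ + 1), ∑ β ∈ Finset.piAntidiag (Finset.univ : Finset (Fin n)) j,
      ⨆ x : Rn n, ‖partialDeriv β f x‖ₑ) +
    ∑ β ∈ Finset.piAntidiag (Finset.univ : Finset (Fin n)) ⌊τ⌋₊,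
      ⨆ (x : Rn n) (y : Rn n) (_ : x ≠ y),
        ENNReal.ofReal (‖partialDeriv β f x - partialDeriv β f y‖ / ‖x - y‖ ^ (τ - ⌊τ⌋₊))

/-- `f ∈ C^τ(ℝⁿ; F)`. -/
def MemCtau {n : ℕ} {F : Type*} [NormedAddCommGroup F] [NormedSpace ℝ F]
    (τ : ℝ) (f : Rn n → F) : Prop :=
  ContDiff ℝ (⌊τ⌋₊ : ℕ) f ∧ ctauNorm τ f < (⊤ : ℝ≥0∞)

/-- `f ∈ C_b^∞(ℝⁿ; F)`: smooth with bounded derivatives of every order (including order `0`). -/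
def MemCbInfty {n : ℕ} {F : Type*} [NormedAddCommGroup F] [NormedSpace ℝ F]
    (f : Rn n → F) : Prop :=
  ContDiff ℝ ∞ f ∧ ∀ α : Fin n → ℕ, ∃ C : ℝ, ∀ x, ‖partialDeriv α f x‖ ≤ C

/-- `⟨ξ⟩ = (1 + |ξ|²)^{1/2}`. -/
def japaneseBracket {n : ℕ} (ξ : Rn n) : ℝ := √(1 + ‖ξ‖ ^ 2)

/-- The symbol class `C^τ S^m_{1,0}(ℝⁿ × ℝⁿ; X)`. The symbol is `p x ξ`. -/
def IsCtauSymbol {n : ℕ} {X : Type*} [NormedAddCommGroup X] [NormedSpace ℝ X]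
    (τ m : ℝ) (p : Rn n → Rn n → X) : Prop :=
  (∀ x, ContDiff ℝ ∞ (p x)) ∧
  ∀ α : Fin n → ℕ,
    (∀ ξ, MemCtau τ (fun x => partialDeriv α (p x) ξ)) ∧
    ∃ C : ℝ, ∀ ξ, ctauNorm τ (fun x => partialDeriv α (p x) ξ) ≤
      ENNReal.ofReal (C * japaneseBracket ξ ^ (m - multiLength α))

/-- The Fourier transform `û(ξ) = ∫ e^{-i y·ξ} u(y) dy`. -/
def fourierHat {n : ℕ} {X₀ : Type*} [NormedAddCommGroup X₀] [NormedSpace ℂ X₀]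
    (u : Rn n → X₀) (ξ : Rn n) : X₀ :=
  ∫ y, Complex.exp (-Complex.I * (inner ℝ y ξ : ℝ)) • u y

/-- The pseudodifferential operator
`(p(x, D_x) u)(x) = (2π)^{-n} ∫ e^{i x·ξ} p(x, ξ) û(ξ) dξ`, for rapidly decreasing `u`. -/
def pseudoOp {n : ℕ} {X₀ X₁ : Type*} [NormedAddCommGroup X₀] [NormedSpace ℂ X₀]
    [NormedAddCommGroup X₁] [NormedSpace ℂ X₁]
    (p : Rn n → Rn n → (X₀ →L[ℂ] X₁)) (u : Rn n → X₀) (x : Rn n) : X₁ :=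
  ((2 * Real.pi) ^ n)⁻¹ •
    ∫ ξ, Complex.exp (Complex.I * (inner ℝ x ξ : ℝ)) • p x ξ (fourierHat u ξ)

/-- The localized operator `φ(x) p(x, D_x) ψ(x)`, i.e. `f ↦ φ · p(x, D_x)(ψ f)`, on Schwartz
functions. -/
def localizedOp {n : ℕ} {X₀ X₁ : Type*} [NormedAddCommGroup X₀] [NormedSpace ℂ X₀]
    [NormedAddCommGroup X₁] [NormedSpace ℂ X₁]
    (φ : Rn n → ℂ) (p : Rn n → Rn n → (X₀ →L[ℂ] X₁)) (ψ : Rn n → ℂ)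
    (f : 𝓢(Rn n, X₀)) (x : Rn n) : X₁ :=
  φ x • pseudoOp p (fun y => ψ y • f y) x

/-- `K` is a `C^τ - C^∞`-kernel of the operator `A`: it represents `A` on Schwartz functions,
it is smooth in the second variable, and all `z^β ∂_z^α K(·, z)` are bounded in `C^τ`
uniformly in `z`. -/
def IsCtauCinftyKernel {n : ℕ} {X₀ X₁ : Type*} [NormedAddCommGroup X₀] [NormedSpace ℂ X₀]
    [NormedAddCommGroup X₁] [NormedSpace ℂ X₁]
    (τ : ℝ) (A : 𝓢(Rn n, X₀) → Rn n → X₁) (K : Rn n → Rn n → (X₀ →L[ℂ] X₁)) : Prop :=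
  (∀ (f : 𝓢(Rn n, X₀)) (x : Rn n), A f x = ∫ y, K x (x - y) (f y)) ∧
  (∀ x, ContDiff ℝ ∞ (K x)) ∧
  ∀ α β : Fin n → ℕ,
    (∀ z, MemCtau τ (fun x => monomialPow β z • partialDeriv α (K x) z)) ∧
    ∃ C : ℝ, ∀ z,
      ctauNorm τ (fun x => monomialPow β z • partialDeriv α (K x) z) ≤ ENNReal.ofReal C

end

end NonsmoothPDO

open MeasureTheory Filter Topology FourierTransform

set_option linter.unusedSectionVars false

namespace NonsmoothPDO

noncomputable section

/-! Formally the kernel is `H(x, z) ∫ e^{i z·ξ} p(x, ξ) dξ` with `H(x, z) = (2π)^{-n} φ(x) ψ(x -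
z)`. The integral need not converge, but disjointness of the closed supports makes `H(x, ·)` vanish
near `z = 0`, which permits integration by parts in `ξ`.

The supports may be at distance zero, so the radius of vanishing depends on `x` and division by
`|z|²` has no uniform bounds. Hadamard's formula is used instead: `H = ∑ zⱼ Hⱼ` with `Hⱼ(x, z) = ∫₀¹
∂ⱼH(x, t z) dt`. Each `Hⱼ` again vanishes near `z = 0` and has bounds controlled by those of `∂ⱼH`
(`IsCutoff.hadamard`, `IsCutoff.eq_sum_hadamard`), so the division can be iterated. Every factor
`zⱼ` is turned by parts into `i ∂_{ξⱼ}` on the symbol, lowering its order by one. After `N > m + n`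
rounds the symbols have order below `-n` and all integrals converge absolutely; the result is `kern
N H p`.

A `z`-derivative of an oscillatory integral costs one order, while multiplication by `zⱼ` gains one
(`pd_oscInt`, `coord_smul_oscInt`). Once convergent, the kernel is unchanged by further rounds
(`kern_succ`), so there are always enough orders in reserve for any prescribed number of derivatives
and moments (`good_kern_all`). Regularity in `x` is carried through by Hölder bounds stable under
sums, products and parameter integrals.

For the representation formula, `x` is frozen and the same integrations by parts are performed
against the Schwartz function obtained from `f`. Its decay makes them legitimate for every order
`m`; Fubini is needed only at the end, for orders below `-n`
(`integral_apply_schwartzOsc_cutoffMul`). -/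

/-- The unit vector `eᵢ`. -/
abbrev unitVec {n : ℕ} (i : Fin n) : Rn n := EuclideanSpace.single i (1 : ℝ)

/-- The first order partial derivative `∂ᵢ f`. -/
def pd {n : ℕ} {F : Type*} [NormedAddCommGroup F] [NormedSpace ℝ F]
    (i : Fin n) (f : Rn n → F) (x : Rn n) : F :=
  fderiv ℝ f x (unitVec i)

/-- The iterated partial derivative along a list of directions. -/
def dl {n : ℕ} {F : Type*} [NormedAddCommGroup F] [NormedSpace ℝ F] :
    List (Fin n) → (Rn n → F) → Rn n → F
  | [], f => f
  | i :: l, f => dl l (pd i f)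

/-! ### Calculus of coordinate derivatives and comparison with multi-index derivatives. -/

section Basic

variable {n : ℕ} {F : Type*} [NormedAddCommGroup F] [NormedSpace ℝ F]

@[simp] lemma dl_nil (f : Rn n → F) : dl [] f = f := rfl

@[simp] lemma dl_cons (i : Fin n) (l : List (Fin n)) (f : Rn n → F) :
    dl (i :: l) f = dl l (pd i f) := rfl

lemma dl_append (l l' : List (Fin n)) (f : Rn n → F) : dl (l ++ l') f = dl l' (dl l f) := by
  induction l generalizing f with
  | nil => rfl
  | cons i l ih => simp [ih]

lemma sum_smul_unitVec (y : Rn n) : ∑ i, y i • (unitVec i : Rn n) = y := by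
  ext j
  simp [unitVec, Finset.sum_apply, Pi.single_apply]

lemma clm_eq_sum (A : Rn n →L[ℝ] F) (y : Rn n) : A y = ∑ i, y i • A (unitVec i) := by
  conv_lhs => rw [← sum_smul_unitVec y]
  simp

lemma norm_clm_le (A : Rn n →L[ℝ] F) {C : ℝ} (h : ∀ i, ‖A (unitVec i)‖ ≤ C) (hC : 0 ≤ C) :
    ‖A‖ ≤ n * C := by
  refine A.opNorm_le_bound (by positivity) fun y => ?_
  rw [clm_eq_sum A y]
  calc ‖∑ i, y i • A (unitVec i)‖ ≤ ∑ _i : Fin n, ‖y‖ * C := by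
        refine norm_sum_le_of_le _ fun i _ => ?_
        rw [norm_smul]
        exact mul_le_mul (PiLp.norm_apply_le y i) (h i) (norm_nonneg _) (norm_nonneg _)
    _ = n * C * ‖y‖ := by simp; ring

lemma fderiv_eq_sum_pd (f : Rn n → F) (x : Rn n) :
    fderiv ℝ f x = ∑ i, (EuclideanSpace.proj i : Rn n →L[ℝ] ℝ).smulRight (pd i f x) := by
  ext y
  rw [clm_eq_sum (fderiv ℝ f x) y]
  simp [pd]

lemma contDiff_succ_iff_pd {f : Rn n → F} {k : ℕ} :
    ContDiff ℝ (k + 1 : ℕ) f ↔ Differentiable ℝ f ∧ ∀ i, ContDiff ℝ k (pd i f) := by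
  push_cast
  rw [contDiff_succ_iff_fderiv_apply]
  constructor
  · rintro ⟨h, -, h'⟩
    exact ⟨h, fun i => h' _⟩
  · rintro ⟨h, h'⟩
    refine ⟨h, by simp, fun y => ?_⟩
    have : (fun x => fderiv ℝ f x y) = fun x => ∑ i, y i • pd i f x := by
      ext x; exact clm_eq_sum _ y
    rw [this]
    exact ContDiff.sum fun i _ => (h' i).const_smul _

lemma ContDiff.pd {f : Rn n → F} {k : ℕ} (hf : ContDiff ℝ (k + 1 : ℕ) f) (i : Fin n) :
    ContDiff ℝ k (pd i f) := (contDiff_succ_iff_pd.1 hf).2 i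

lemma ContDiff.pd_infty {f : Rn n → F} (hf : ContDiff ℝ ∞ f) (i : Fin n) :
    ContDiff ℝ ∞ (NonsmoothPDO.pd i f) :=
  contDiff_infty.2 fun k => ContDiff.pd (contDiff_infty.1 hf (k + 1)) i

lemma ContDiff.dl_infty {f : Rn n → F} (hf : ContDiff ℝ ∞ f) (l : List (Fin n)) :
    ContDiff ℝ ∞ (dl l f) := by
  induction l generalizing f with
  | nil => exact hf
  | cons i l ih => exact ih (ContDiff.pd_infty hf i)

lemma differentiable_of_smooth {f : Rn n → F} (hf : ContDiff ℝ ∞ f) : Differentiable ℝ f :=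
  hf.differentiable (by simp)

/-! ### Linearity and the product rule -/

lemma pd_add {f g : Rn n → F} (hf : Differentiable ℝ f) (hg : Differentiable ℝ g) (i : Fin n) :
    pd i (fun x => f x + g x) = fun x => pd i f x + pd i g x := by
  ext x
  simp [pd, fderiv_fun_add (hf x) (hg x)]

lemma pd_smul [NormedSpace ℂ F] [IsScalarTower ℝ ℂ F] {f : Rn n → ℂ} {g : Rn n → F}
    (hf : Differentiable ℝ f) (hg : Differentiable ℝ g) (i : Fin n) :
    pd i (fun x => f x • g x) = fun x => pd i f x • g x + f x • pd i g x := by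
  ext x
  simp only [pd]
  rw [fderiv_fun_smul (hf x) (hg x)]
  simp [add_comm]

lemma pd_const_smul [NormedSpace ℂ F] [IsScalarTower ℝ ℂ F] (c : ℂ) {g : Rn n → F}
    (hg : Differentiable ℝ g) (i : Fin n) :
    pd i (fun x => c • g x) = fun x => c • pd i g x := by
  rw [pd_smul (differentiable_const c) hg]
  ext x
  simp [pd]

lemma dl_add {f g : Rn n → F} (hf : ContDiff ℝ ∞ f) (hg : ContDiff ℝ ∞ g) (l : List (Fin n)) :
    dl l (fun x => f x + g x) = fun x => dl l f x + dl l g x := by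
  induction l generalizing f g with
  | nil => rfl
  | cons i l ih =>
    simp only [dl_cons]
    rw [pd_add (differentiable_of_smooth hf) (differentiable_of_smooth hg),
      ih (ContDiff.pd_infty hf i) (ContDiff.pd_infty hg i)]

lemma dl_const_smul [NormedSpace ℂ F] [IsScalarTower ℝ ℂ F] (c : ℂ) {g : Rn n → F}
    (hg : ContDiff ℝ ∞ g) (l : List (Fin n)) :
    dl l (fun x => c • g x) = fun x => c • dl l g x := by
  induction l generalizing g with
  | nil => rfl
  | cons i l ih =>
    simp only [dl_cons]
    rw [pd_const_smul c (differentiable_of_smooth hg), ih (ContDiff.pd_infty hg i)]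

/-! ### Multi-index derivatives -/

lemma pd_comm {f : Rn n → F} (hf : ContDiff ℝ 2 f) (i j : Fin n) :
    pd i (pd j f) = pd j (pd i f) := by
  ext x
  have hd : DifferentiableAt ℝ (fderiv ℝ f) x :=
    (hf.fderiv_right (m := 1) (by norm_num)).differentiable (by simp) x
  have key : ∀ a b : Fin n, pd a (pd b f) x =
      fderiv ℝ (fderiv ℝ f) x (unitVec a) (unitVec b) := fun a b => by
    have h := (hd.hasFDerivAt.clm_apply (hasFDerivAt_const (unitVec b : Rn n) x)).fderiv
    simp only [pd]
    change fderiv ℝ (fun y => fderiv ℝ f y (unitVec b)) x (unitVec a) = _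
    rw [h]
    simp
  rw [key, key]
  exact hf.contDiffAt.isSymmSndFDerivAt (by simp) _ _

/-- The iterated partial derivative does not depend on the order of differentiation. -/
lemma dl_perm {l l' : List (Fin n)} (h : l.Perm l') {f : Rn n → F}
    (hf : ContDiff ℝ l.length f) : dl l f = dl l' f := by
  induction h generalizing f with
  | nil => rfl
  | cons i _ ih => exact ih (ContDiff.pd hf i)
  | swap i j l =>
    simp only [dl_cons]
    rw [pd_comm (hf.of_le (by simp only [List.length_cons]; push_cast; rw [add_assoc]; norm_num))]
  | trans h₁ _ ih₁ ih₂ => rw [ih₁ hf, ih₂ (h₁.length_eq ▸ hf)]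

/-- The last slot of `iteratedFDeriv` is the innermost derivative, and the head of a list is
differentiated first; peeling off the last slot therefore builds the list from its head. -/
lemma iteratedFDeriv_eq_dl {N : ℕ} (w : Fin N → Fin n) : ∃ l : List (Fin n),
    (∀ i, l.count i = ∑ j, if w j = i then 1 else 0) ∧
    ∀ f : Rn n → F, ContDiff ℝ N f → ∀ x,
      iteratedFDeriv ℝ N f x (fun j => unitVec (w j)) = dl l f x := by
  induction N with
  | zero => exact ⟨[], by simp, by simp⟩
  | succ N ih =>
    obtain ⟨l, hl, h⟩ := ih (Fin.init w)
    refine ⟨w (Fin.last N) :: l, fun k => ?_, fun f hf x => ?_⟩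
    · rw [List.count_cons, hl k, Fin.sum_univ_castSucc]
      simp only [Fin.init, beq_iff_eq]
      congr!
    · rw [dl_cons, ← h _ (ContDiff.pd hf _), iteratedFDeriv_succ_apply_right]
      have hfd : ContDiff ℝ N (fderiv ℝ f) := hf.fderiv_right (by simp)
      have hc := (ContinuousLinearMap.apply ℝ F
        (unitVec (w (Fin.last N)) : Rn n)).iteratedFDeriv_comp_left
        (f := fderiv ℝ f) (x := x) hfd.contDiffAt (i := N) le_rfl
      have : pd (w (Fin.last N)) f =
        (ContinuousLinearMap.apply ℝ F (unitVec (w (Fin.last N)) : Rn n)) ∘ fderiv ℝ f := rfl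
      rw [this, hc]
      rfl

lemma sum_count (l : List (Fin n)) : ∑ i, l.count i = l.length := by
  induction l with
  | nil => simp
  | cons i l ih => simp [List.count_cons, Finset.sum_add_distrib, ih]

/-- The iterated partial derivative along a list only depends on the multiplicities. -/
lemma dl_eq_partialDeriv (l : List (Fin n)) {f : Rn n → F} (hf : ContDiff ℝ l.length f)
    (x : Rn n) : dl l f x = partialDeriv (fun i => l.count i) f x := by
  obtain ⟨l', hl', h⟩ := iteratedFDeriv_eq_dl (F := F)
    (fun j : Fin (∑ i, l.count i) => (finSigmaFinEquiv.symm j).1)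
  rw [partialDeriv, h f (by rwa [sum_count])]
  refine congrFun (dl_perm (List.perm_iff_count.2 fun i => ?_) hf) x
  rw [hl', Equiv.sum_comp finSigmaFinEquiv.symm
    (fun s : (i : Fin n) × Fin (l.count i) => if s.1 = i then 1 else 0)]
  rw [Fintype.sum_sigma]
  simp [apply_ite Finset.card]

/-- A list of directions that realizes a multi-index. -/
def multiList (α : Fin n → ℕ) : List (Fin n) := (∑ i, α i • ({i} : Multiset (Fin n))).toList

lemma count_multiList (α : Fin n → ℕ) (i : Fin n) : (multiList α).count i = α i := by
  rw [multiList, ← Multiset.coe_count, Multiset.coe_toList, Multiset.count_sum']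
  simp [Multiset.count_singleton]

lemma length_multiList (α : Fin n → ℕ) : (multiList α).length = ∑ i, α i := by
  simp [multiList]

lemma partialDeriv_eq_dl (α : Fin n → ℕ) {f : Rn n → F} (hf : ContDiff ℝ (∑ i, α i : ℕ) f)
    (x : Rn n) : partialDeriv α f x = dl (multiList α) f x := by
  rw [dl_eq_partialDeriv _ (by rwa [length_multiList])]
  congr 1
  ext i
  exact (count_multiList α i).symm

end Basic

/-! ### Hölder classes with explicit constants. -/

/-- `f` has bounded partial derivatives up to order `k`, and those of order `k` are `θ`-Hölder
continuous, with all constants at most `C`. -/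
def HB {n : ℕ} {F : Type*} [NormedAddCommGroup F] [NormedSpace ℝ F] (k : ℕ) (θ C : ℝ)
    (f : Rn n → F) : Prop :=
  match k with
  | 0 => Continuous f ∧ (∀ x, ‖f x‖ ≤ C) ∧ ∀ x y, ‖f x - f y‖ ≤ C * ‖x - y‖ ^ θ
  | k + 1 => ContDiff ℝ 1 f ∧ (∀ x, ‖f x‖ ≤ C) ∧ ∀ i, HB k θ C (pd i f)

section Holder

variable {n : ℕ} {F : Type*} [NormedAddCommGroup F] [NormedSpace ℝ F] {k : ℕ} {θ C C' : ℝ}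
  {f g : Rn n → F}

lemma HB.bound (h : HB k θ C f) (x : Rn n) : ‖f x‖ ≤ C := by
  cases k with
  | zero => exact h.2.1 x
  | succ k => exact h.2.1 x

lemma HB.nonneg (h : HB k θ C f) : 0 ≤ C := (norm_nonneg _).trans (h.bound 0)

lemma HB.contDiff (h : HB k θ C f) : ContDiff ℝ k f := by
  induction k generalizing f with
  | zero => exact contDiff_zero.2 h.1
  | succ k ih =>
    exact contDiff_succ_iff_pd.2 ⟨h.1.differentiable (by simp), fun i => ih (h.2.2 i)⟩

lemma HB.continuous (h : HB k θ C f) : Continuous f := h.contDiff.continuous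

lemma HB.mono (h : HB k θ C f) (hC : C ≤ C') : HB k θ C' f := by
  induction k generalizing f with
  | zero =>
    exact ⟨h.1, fun x => (h.2.1 x).trans hC, fun x y => (h.2.2 x y).trans (by gcongr)⟩
  | succ k ih => exact ⟨h.1, fun x => (h.2.1 x).trans hC, fun i => ih (h.2.2 i)⟩

lemma pd_zero (i : Fin n) : pd i (fun _ : Rn n => (0 : F)) = fun _ => 0 := by
  ext x; simp [pd]

lemma HB.zero : HB k θ 0 (fun _ : Rn n => (0 : F)) := by
  induction k with
  | zero => exact ⟨continuous_const, by simp, by simp⟩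
  | succ k ih => exact ⟨contDiff_const, by simp, fun i => by rw [pd_zero]; exact ih⟩

lemma HB.add (hf : HB k θ C f) (hg : HB k θ C' g) : HB k θ (C + C') (fun x => f x + g x) := by
  induction k generalizing f g with
  | zero =>
    refine ⟨hf.1.add hg.1, fun x => norm_add_le_of_le (hf.2.1 x) (hg.2.1 x), fun x y => ?_⟩
    rw [add_sub_add_comm, add_mul]
    exact norm_add_le_of_le (hf.2.2 x y) (hg.2.2 x y)
  | succ k ih =>
    refine ⟨hf.1.add hg.1, fun x => norm_add_le_of_le (hf.2.1 x) (hg.2.1 x), fun i => ?_⟩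
    rw [pd_add (hf.1.differentiable (by simp)) (hg.1.differentiable (by simp))]
    exact ih (hf.2.2 i) (hg.2.2 i)

lemma norm_sub_le_of_pd_le {C : ℝ} (hf : Differentiable ℝ f) (hC : 0 ≤ C)
    (h : ∀ i x, ‖pd i f x‖ ≤ C) (x y : Rn n) : ‖f x - f y‖ ≤ n * C * ‖x - y‖ :=
  convex_univ.norm_image_sub_le_of_norm_fderiv_le (fun z _ => hf z)
    (fun z _ => norm_clm_le _ (fun i => h i z) hC) (Set.mem_univ y) (Set.mem_univ x)

/-- For `‖x - y‖ ≤ 1` the mean value inequality gives `n C ‖x - y‖`, and `θ ≤ 1` helps; for larger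
distances the sup bound gives `2 C`. The factor `n + 2` covers both. -/
lemma HB.of_pd_le (hθ0 : 0 ≤ θ) (hθ1 : θ ≤ 1) (hf : ContDiff ℝ 1 f) (hb : ∀ x, ‖f x‖ ≤ C)
    (hb' : ∀ i x, ‖pd i f x‖ ≤ C) : HB 0 θ ((n + 2) * C) f := by
  have hC : 0 ≤ C := (norm_nonneg _).trans (hb 0)
  have hle : C ≤ (n + 2) * C := by nlinarith [(Nat.cast_nonneg n : (0 : ℝ) ≤ n)]
  refine ⟨hf.continuous, fun x => (hb x).trans hle, fun x y => ?_⟩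
  rcases eq_or_ne x y with rfl | hxy
  · simp only [sub_self, norm_zero]
    positivity
  have hpos : 0 < ‖x - y‖ := norm_pos_iff.2 (sub_ne_zero.2 hxy)
  rcases le_total ‖x - y‖ 1 with h1 | h1
  · have hr : ‖x - y‖ ≤ ‖x - y‖ ^ θ := by
      simpa using Real.rpow_le_rpow_of_exponent_ge hpos h1 hθ1
    calc ‖f x - f y‖ ≤ n * C * ‖x - y‖ :=
          norm_sub_le_of_pd_le (hf.differentiable (by simp)) hC hb' x y
      _ ≤ n * C * ‖x - y‖ ^ θ := by gcongr
      _ ≤ (n + 2) * C * ‖x - y‖ ^ θ := by gcongr; linarith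
  · have hr : 1 ≤ ‖x - y‖ ^ θ := Real.one_le_rpow h1 hθ0
    calc ‖f x - f y‖ ≤ C + C := norm_sub_le_of_le (hb x) (hb y)
      _ = 2 * C * 1 := by ring
      _ ≤ 2 * C * ‖x - y‖ ^ θ := by gcongr
      _ ≤ (n + 2) * C * ‖x - y‖ ^ θ := by
        gcongr
        linarith [(Nat.cast_nonneg n : (0 : ℝ) ≤ n)]

/-- Needed in the product rule, where an undifferentiated factor of class `k + 1` multiplies a
derivative of class `k`. -/
lemma HB.of_succ (hθ0 : 0 ≤ θ) (hθ1 : θ ≤ 1) (h : HB (k + 1) θ C f) :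
    HB k θ ((n + 2) * C) f := by
  have hC := h.nonneg
  have hle : C ≤ (n + 2) * C := by nlinarith [(Nat.cast_nonneg n : (0 : ℝ) ≤ n)]
  induction k generalizing f with
  | zero => exact HB.of_pd_le hθ0 hθ1 h.1 h.2.1 fun i => (h.2.2 i).bound
  | succ k ih => exact ⟨h.1, fun x => (h.2.1 x).trans hle, fun i => ih (h.2.2 i)⟩

lemma pd_comp_sub_const (i : Fin n) (z : Rn n) :
    pd i (fun x => f (x - z)) = fun x => pd i f (x - z) := by
  ext x
  simp only [pd]
  rw [fderiv_comp_sub]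

lemma HB.comp_sub_const (h : HB k θ C f) (z : Rn n) : HB k θ C (fun x => f (x - z)) := by
  induction k generalizing f with
  | zero =>
    exact ⟨h.1.comp (continuous_id.sub continuous_const), fun x => h.2.1 _,
      fun x y => by simpa using h.2.2 (x - z) (y - z)⟩
  | succ k ih =>
    refine ⟨h.1.comp (contDiff_id.sub contDiff_const), fun x => h.2.1 _, fun i => ?_⟩
    rw [pd_comp_sub_const]
    exact ih (h.2.2 i)

/-- A smooth function with bounded derivatives belongs to all Hölder classes. -/
lemma HB.of_smooth (hθ0 : 0 ≤ θ) (hθ1 : θ ≤ 1) (hf : ContDiff ℝ ∞ f)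
    (hb : ∀ l : List (Fin n), ∃ C, ∀ x, ‖dl l f x‖ ≤ C) (k : ℕ) : ∃ C, HB k θ C f := by
  obtain ⟨C, hC⟩ := hb []
  have hC0 : 0 ≤ C := (norm_nonneg _).trans (hC 0)
  induction k generalizing f C with
  | zero =>
    choose D hD using fun i => hb [i]
    have hD0 : ∀ i, 0 ≤ D i := fun i => (norm_nonneg _).trans (hD i 0)
    refine ⟨_, HB.of_pd_le (C := C + ∑ i, D i) hθ0 hθ1 (hf.of_le (by simp))
      (fun x => (hC x).trans ?_) fun i x => (hD i x).trans ?_⟩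
    · linarith [Finset.sum_nonneg fun i (_ : i ∈ Finset.univ) => hD0 i]
    · linarith [Finset.single_le_sum (fun i _ => hD0 i) (Finset.mem_univ i)]
  | succ k ih =>
    have : ∀ i, ∃ D, HB k θ D (pd i f) := fun i => by
      obtain ⟨D, hD⟩ := hb [i]
      exact ih (ContDiff.pd_infty hf i) (fun l => hb (i :: l)) D hD
        ((norm_nonneg _).trans (hD 0))
    choose D hD using this
    have hD0 : ∀ i, 0 ≤ D i := fun i => (hD i).nonneg
    refine ⟨C + ∑ i, D i, hf.of_le (by simp), fun x => (hC x).trans ?_, fun i => (hD i).mono ?_⟩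
    · linarith [Finset.sum_nonneg fun i (_ : i ∈ Finset.univ) => hD0 i]
    · linarith [Finset.single_le_sum (fun i _ => hD0 i) (Finset.mem_univ i)]

variable [NormedSpace ℂ F] [IsScalarTower ℝ ℂ F]

lemma HB.const_smul (c : ℂ) (hf : HB k θ C f) : HB k θ (‖c‖ * C) (fun x => c • f x) := by
  induction k generalizing f with
  | zero =>
    refine ⟨hf.1.const_smul c, fun x => ?_, fun x y => ?_⟩
    · rw [norm_smul]; gcongr; exact hf.2.1 x
    · rw [← smul_sub, norm_smul, mul_assoc]; gcongr; exact hf.2.2 x y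
  | succ k ih =>
    refine ⟨contDiff_const.smul hf.1, fun x => ?_, fun i => ?_⟩
    · rw [norm_smul]; gcongr; exact hf.2.1 x
    · rw [pd_const_smul c (hf.1.differentiable (by simp))]
      exact ih (hf.2.2 i)

/-- The Hölder classes are stable under multiplication. -/
lemma HB.smul (n k : ℕ) (hθ0 : 0 ≤ θ) (hθ1 : θ ≤ 1) : ∃ D : ℝ, 0 ≤ D ∧
    ∀ {f : Rn n → ℂ} {g : Rn n → F} {C C' : ℝ}, HB k θ C f → HB k θ C' g →
      HB k θ (D * (C * C')) (fun x => f x • g x) := by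
  induction k with
  | zero =>
    refine ⟨2, by norm_num, fun {f g C C'} hf hg => ⟨hf.1.smul hg.1, fun x => ?_, fun x y => ?_⟩⟩
    · rw [norm_smul]
      have := mul_le_mul (hf.2.1 x) (hg.2.1 x) (norm_nonneg _) hf.nonneg
      nlinarith [mul_nonneg hf.nonneg hg.nonneg]
    · have hC := hf.nonneg
      have hC' := hg.nonneg
      have : f x • g x - f y • g y = f x • (g x - g y) + (f x - f y) • g y := by
        rw [smul_sub, sub_smul]; abel
      rw [this]
      calc ‖f x • (g x - g y) + (f x - f y) • g y‖
          ≤ C * (C' * ‖x - y‖ ^ θ) + C * ‖x - y‖ ^ θ * C' := by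
            refine norm_add_le_of_le ?_ ?_
            · rw [norm_smul]
              exact mul_le_mul (hf.2.1 x) (hg.2.2 x y) (norm_nonneg _) hC
            · rw [norm_smul]
              exact mul_le_mul (hf.2.2 x y) (hg.2.1 y) (norm_nonneg _)
                ((norm_nonneg _).trans (hf.2.2 x y))
        _ = 2 * (C * C') * ‖x - y‖ ^ θ := by ring
  | succ k ih =>
    obtain ⟨D, hD, h⟩ := ih
    -- Two Leibniz terms, each costing `D` for the product and `n + 2` for lowering the class of one
    -- factor; the `1` covers the sup bound of the product itself.
    refine ⟨2 * D * (n + 2) + 1, by positivity, fun {f g C C'} hf hg => ?_⟩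
    have hC := hf.nonneg
    have hC' := hg.nonneg
    refine ⟨hf.1.smul hg.1, fun x => ?_, fun i => ?_⟩
    · rw [norm_smul]
      have h1 := mul_le_mul (hf.2.1 x) (hg.2.1 x) (norm_nonneg _) hC
      have h2 : 0 ≤ 2 * D * (n + 2) * (C * C') := by positivity
      nlinarith
    · rw [pd_smul (hf.1.differentiable (by simp)) (hg.1.differentiable (by simp))]
      refine ((h (hf.2.2 i) (hg.of_succ hθ0 hθ1)).add
        (h (hf.of_succ hθ0 hθ1) (hg.2.2 i))).mono ?_
      have h2 : 0 ≤ C * C' := by positivity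
      nlinarith

end Holder

/-! ### Integrals depending on a parameter. -/

section Integral

variable {n : ℕ} {F : Type*} [NormedAddCommGroup F] [NormedSpace ℝ F]
  {T : Type*} [MeasurableSpace T] {μ : Measure T} {g : Rn n → T → F} {b : T → ℝ}

/-- The derivative is the pointwise limit of the measurable difference quotients with step `c⁻¹`, as
`c → ∞`. -/
lemma aestronglyMeasurable_pd (hm : ∀ x, AEStronglyMeasurable (g x) μ)
    (hd : ∀ t, Differentiable ℝ (fun x => g x t)) (i : Fin n) (x : Rn n) :
    AEStronglyMeasurable (fun t => pd i (fun x => g x t) x) μ := by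
  refine aestronglyMeasurable_of_tendsto_ae (atTop : Filter ℝ)
    (f := fun c t => c • (g (x + c⁻¹ • unitVec i) t - g x t))
    (fun c => ((hm _).sub (hm _)).const_smul c) (ae_of_all _ fun t => ?_)
  exact (hd t x).hasFDerivAt.lim_real (unitVec i)

/-- Differentiation under the integral sign. -/
lemma contDiff_one_integral (hm : ∀ x, AEStronglyMeasurable (g x) μ)
    (hd : ∀ t, ContDiff ℝ 1 (fun x => g x t)) (hb : ∀ x t, ‖g x t‖ ≤ b t)
    (hb' : ∀ i x t, ‖pd i (fun x => g x t) x‖ ≤ b t) (hbi : Integrable b μ) :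
    ContDiff ℝ 1 (fun x => ∫ t, g x t ∂μ) ∧
      ∀ i, pd i (fun x => ∫ t, g x t ∂μ) = fun x => ∫ t, pd i (fun x => g x t) x ∂μ := by
  have hdiff : ∀ t, Differentiable ℝ (fun x => g x t) := fun t => (hd t).differentiable (by simp)
  have hmp := aestronglyMeasurable_pd hm hdiff
  have hfm : ∀ x, AEStronglyMeasurable (fun t => fderiv ℝ (fun x => g x t) x) μ := fun x => by
    simp_rw [fderiv_eq_sum_pd]
    exact Finset.aestronglyMeasurable_fun_sum _ fun i _ =>
      ((ContinuousLinearMap.smulRightL ℝ (Rn n) F (EuclideanSpace.proj i)).continuous).comp_aestronglyMeasurable (hmp i x)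
  have hF : ∀ x, HasFDerivAt (fun x => ∫ t, g x t ∂μ)
      (∫ t, fderiv ℝ (fun x => g x t) x ∂μ) x := fun x =>
    hasFDerivAt_integral_of_dominated_of_fderiv_le (F' := fun x t => fderiv ℝ (fun x => g x t) x)
      (bound := fun t => n * b t)
      univ_mem (Eventually.of_forall hm)
      (hbi.mono' (hm x) (ae_of_all _ (hb x))) (hfm x)
      (ae_of_all _ fun t y _ => norm_clm_le _ (fun i => hb' i y t)
        ((norm_nonneg _).trans (hb y t)))
      (hbi.const_mul _) (ae_of_all _ fun t y _ => (hdiff t y).hasFDerivAt)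
  have hpd : ∀ i, pd i (fun x => ∫ t, g x t ∂μ) =
      fun x => ∫ t, pd i (fun x => g x t) x ∂μ := fun i => by
    ext x
    rw [pd, (hF x).fderiv]
    refine (ContinuousLinearMap.integral_apply ?_ _).trans rfl
    exact (hbi.const_mul n).mono' (hfm x) (ae_of_all _ fun t =>
      norm_clm_le _ (fun i => hb' i x t) ((norm_nonneg _).trans (hb x t)))
  refine ⟨?_, hpd⟩
  have := (contDiff_succ_iff_pd (k := 0) (f := fun x => ∫ t, g x t ∂μ)).2
    ⟨fun x => (hF x).differentiableAt, fun i => ?_⟩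
  · simpa using this
  · rw [hpd i]
    refine contDiff_zero.2 (continuous_of_dominated (hmp i) (fun x => ae_of_all _ (hb' i x)) hbi
      (ae_of_all _ fun t => ?_))
    exact (ContDiff.pd (k := 0) (by simpa using hd t) i).continuous

/-- The Hölder classes are stable under integration over a parameter. -/
lemma HB.integral {k : ℕ} {θ : ℝ} (hm : ∀ x, AEStronglyMeasurable (g x) μ)
    (h : ∀ t, HB k θ (b t) (fun x => g x t)) (hbi : Integrable b μ) :
    HB k θ (∫ t, b t ∂μ) (fun x => ∫ t, g x t ∂μ) := by
  have hbd : ∀ x, ‖∫ t, g x t ∂μ‖ ≤ ∫ t, b t ∂μ := fun x =>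
    norm_integral_le_of_norm_le hbi (ae_of_all _ fun t => (h t).bound x)
  induction k generalizing g with
  | zero =>
    refine ⟨continuous_of_dominated hm (fun x => ae_of_all _ fun t => (h t).bound x) hbi
      (ae_of_all _ fun t => (h t).continuous), hbd, fun x y => ?_⟩
    have hi : ∀ x, Integrable (g x) μ := fun x =>
      hbi.mono' (hm x) (ae_of_all _ fun t => (h t).bound x)
    rw [← integral_sub (hi x) (hi y), ← integral_mul_const]
    exact norm_integral_le_of_norm_le (hbi.mul_const _) (ae_of_all _ fun t => (h t).2.2 x y)
  | succ k ih =>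
    obtain ⟨h1, h2⟩ := contDiff_one_integral hm (fun t => (h t).1) (fun x t => (h t).bound x)
      (fun i x t => ((h t).2.2 i).bound x) hbi
    refine ⟨h1, hbd, fun i => ?_⟩
    rw [h2]
    exact ih (aestronglyMeasurable_pd hm (fun t => (h t).1.differentiable (by simp)) i)
      (fun t => (h t).2.2 i) fun x =>
        norm_integral_le_of_norm_le hbi (ae_of_all _ fun t => ((h t).2.2 i).bound x)

end Integral

/-! ### Comparison with the Hölder norm -/

section Norm

variable {n : ℕ} {F : Type*} [NormedAddCommGroup F] [NormedSpace ℝ F] {k : ℕ} {θ C τ : ℝ}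
  {f : Rn n → F}

lemma HB_iff_dl : HB k θ C f ↔ ContDiff ℝ k f ∧
    (∀ l : List (Fin n), l.length ≤ k → ∀ x, ‖dl l f x‖ ≤ C) ∧
    ∀ l : List (Fin n), l.length = k → ∀ x y, ‖dl l f x - dl l f y‖ ≤ C * ‖x - y‖ ^ θ := by
  refine ⟨fun h => ⟨h.contDiff, fun l hl => ?_, fun l hl => ?_⟩, fun h => ?_⟩
  · induction l generalizing k f with
    | nil => exact h.bound
    | cons i l ih =>
      cases k with
      | zero => simp at hl
      | succ k => exact ih (h.2.2 i) (by simpa using hl)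
  · induction l generalizing k f with
    | nil => obtain rfl := hl; exact h.2.2
    | cons i l ih => obtain rfl := hl; exact ih (h.2.2 i) rfl
  · induction k generalizing f with
    | zero => exact ⟨h.1.continuous, h.2.1 [] (by simp), h.2.2 [] rfl⟩
    | succ k ih =>
      refine ⟨h.1.of_le (by simp), h.2.1 [] (by simp), fun i => ih ⟨ContDiff.pd h.1 i,
        fun l hl => h.2.1 (i :: l) (by simpa using hl),
        fun l hl => h.2.2 (i :: l) (by simpa using hl)⟩⟩

lemma HB.of_ctauNorm_le (hf : ContDiff ℝ (⌊τ⌋₊ : ℕ) f) (hC : 0 ≤ C)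
    (h : ctauNorm τ f ≤ ENNReal.ofReal C) : HB ⌊τ⌋₊ (τ - ⌊τ⌋₊) C f := by
  have hcd : ∀ l : List (Fin n), l.length ≤ ⌊τ⌋₊ → ContDiff ℝ l.length f := fun l hl =>
    hf.of_le (by exact_mod_cast hl)
  refine HB_iff_dl.2 ⟨hf, fun l hl x => ?_, fun l hl x y => ?_⟩
  · rw [dl_eq_partialDeriv l (hcd l hl)]
    rw [← ENNReal.ofReal_le_ofReal_iff hC, ofReal_norm]
    refine le_trans ?_ h
    refine le_trans ?_ le_self_add
    refine le_trans ?_ (Finset.single_le_sum (fun _ _ => zero_le)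
      (Finset.mem_range.2 (Nat.lt_succ_of_le hl)))
    refine le_trans ?_ (Finset.single_le_sum (fun _ _ => zero_le)
      (Finset.mem_piAntidiag.2 ⟨sum_count l, fun i _ => Finset.mem_univ i⟩))
    exact le_iSup (fun x => ‖partialDeriv (fun i => l.count i) f x‖ₑ) x
  · rcases eq_or_ne x y with rfl | hxy
    · simp only [sub_self, norm_zero]
      positivity
    have hpos : 0 < ‖x - y‖ := norm_pos_iff.2 (sub_ne_zero.2 hxy)
    rw [dl_eq_partialDeriv l (hcd l hl.le), dl_eq_partialDeriv l (hcd l hl.le),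
      ← div_le_iff₀ (by positivity)]
    rw [← ENNReal.ofReal_le_ofReal_iff hC]
    refine le_trans ?_ h
    refine le_trans ?_ le_add_self
    refine le_trans ?_ (Finset.single_le_sum (fun _ _ => zero_le)
      (Finset.mem_piAntidiag.2 ⟨(sum_count l).trans hl, fun i _ => Finset.mem_univ i⟩))
    exact le_iSup_of_le x (le_iSup_of_le y (le_iSup_of_le hxy le_rfl))

/-- `N` counts the summands of the norm. It depends only on `n` and `τ`, so bounds uniform in `z`
stay uniform. -/
lemma ctauNorm_le_of_HB (n : ℕ) (τ : ℝ) : ∃ N : ℕ, ∀ {f : Rn n → F} {C : ℝ},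
    HB ⌊τ⌋₊ (τ - ⌊τ⌋₊) C f → ctauNorm τ f ≤ ENNReal.ofReal (N * C) := by
  refine ⟨(∑ j ∈ Finset.range (⌊τ⌋₊ + 1),
      (Finset.piAntidiag (Finset.univ : Finset (Fin n)) j).card) +
      (Finset.piAntidiag (Finset.univ : Finset (Fin n)) ⌊τ⌋₊).card, fun {f C} h => ?_⟩
  have hC := h.nonneg
  obtain ⟨h1, h2, h3⟩ := HB_iff_dl.1 h
  have key : ∀ j ≤ ⌊τ⌋₊, ∀ β ∈ Finset.piAntidiag (Finset.univ : Finset (Fin n)) j,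
      (multiList β).length = j ∧ ∀ x, partialDeriv β f x = dl (multiList β) f x := by
    intro j hj β hβ
    have hs : ∑ i, β i = j := (Finset.mem_piAntidiag.1 hβ).1
    refine ⟨by rw [length_multiList, hs], partialDeriv_eq_dl β (h1.of_le ?_)⟩
    rw [hs]
    exact_mod_cast hj
  rw [ENNReal.ofReal_mul (by positivity), ENNReal.ofReal_natCast]
  push_cast
  rw [add_mul, Finset.sum_mul]
  refine add_le_add (Finset.sum_le_sum fun j hj => ?_) ?_
  · rw [← nsmul_eq_mul]
    refine Finset.sum_le_card_nsmul _ _ _ fun β hβ => iSup_le fun x => ?_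
    obtain ⟨hl, hx⟩ := key j (Nat.lt_succ_iff.1 (Finset.mem_range.1 hj)) β hβ
    rw [hx, ← ofReal_norm]
    exact ENNReal.ofReal_le_ofReal
      (h2 _ (hl.trans_le (Nat.lt_succ_iff.1 (Finset.mem_range.1 hj))) x)
  · rw [← nsmul_eq_mul]
    refine Finset.sum_le_card_nsmul _ _ _ fun β hβ =>
      iSup_le fun x => iSup_le fun y => iSup_le fun hxy => ?_
    obtain ⟨hl, hx⟩ := key _ le_rfl β hβ
    have hpos : 0 < ‖x - y‖ := norm_pos_iff.2 (sub_ne_zero.2 hxy)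
    rw [hx, hx]
    refine ENNReal.ofReal_le_ofReal ?_
    rw [div_le_iff₀ (by positivity)]
    exact h3 _ hl x y

lemma HB.memCtau (h : HB ⌊τ⌋₊ (τ - ⌊τ⌋₊) C f) : MemCtau τ f := by
  obtain ⟨N, hN⟩ := ctauNorm_le_of_HB (F := F) n τ
  exact ⟨h.contDiff, (hN h).trans_lt ENNReal.ofReal_lt_top⟩

end Norm

/-! ### Symbols and cutoff functions. -/

/-- `a(x, ξ)` is smooth in `ξ`, and the derivatives of order `j` in `ξ` are bounded by a multiple of
`w j ξ` in a Hölder class with respect to `x`. -/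
def Bd {n : ℕ} {F : Type*} [NormedAddCommGroup F] [NormedSpace ℝ F] (k : ℕ) (θ : ℝ)
    (w : ℕ → Rn n → ℝ) (a : Rn n → Rn n → F) : Prop :=
  (∀ x, ContDiff ℝ ∞ (a x)) ∧
    ∀ l : List (Fin n), ∃ C : ℝ, 0 ≤ C ∧ ∀ ξ, HB k θ (C * w l.length ξ) (fun x => dl l (a x) ξ)

/-- The symbols of order `m`. -/
def Symb {n : ℕ} {F : Type*} [NormedAddCommGroup F] [NormedSpace ℝ F] (k : ℕ) (θ m : ℝ)
    (a : Rn n → Rn n → F) : Prop :=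
  Bd k θ (fun j ξ => japaneseBracket ξ ^ (m - j)) a

/-- Cutoff functions `H(x, z)` that are bounded with all derivatives and vanish for small `z`. -/
def IsCutoff {n : ℕ} (k : ℕ) (θ : ℝ) (H : Rn n → Rn n → ℂ) : Prop :=
  Bd k θ (fun _ _ => 1) H ∧ ∀ x, ∀ᶠ z in 𝓝 0, H x z = 0

section Classes

variable {n : ℕ} {F : Type*} [NormedAddCommGroup F] [NormedSpace ℝ F] {k : ℕ} {θ m : ℝ}
  {w : ℕ → Rn n → ℝ} {a : Rn n → Rn n → F}

lemma Bd.pd (h : Bd k θ w a) (i : Fin n) :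
    Bd k θ (fun j => w (j + 1)) (fun x => NonsmoothPDO.pd i (a x)) :=
  ⟨fun x => ContDiff.pd_infty (h.1 x) i, fun l => h.2 (i :: l)⟩

lemma Bd.const_smul [NormedSpace ℂ F] [IsScalarTower ℝ ℂ F] (h : Bd k θ w a) (c : ℂ) :
    Bd k θ w (fun x ξ => c • a x ξ) := by
  refine ⟨fun x => contDiff_const.smul (h.1 x), fun l => ?_⟩
  obtain ⟨C, hC, hb⟩ := h.2 l
  refine ⟨‖c‖ * C, by positivity, fun ξ => ?_⟩
  simp only [dl_const_smul c (h.1 _), mul_assoc]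
  exact (hb ξ).const_smul c

lemma one_le_japaneseBracket (ξ : Rn n) : 1 ≤ japaneseBracket ξ :=
  Real.one_le_sqrt.2 (by nlinarith [sq_nonneg ‖ξ‖])

lemma japaneseBracket_pos (ξ : Rn n) : 0 < japaneseBracket ξ :=
  one_pos.trans_le (one_le_japaneseBracket ξ)

lemma norm_le_japaneseBracket (ξ : Rn n) : ‖ξ‖ ≤ japaneseBracket ξ :=
  Real.le_sqrt_of_sq_le (by linarith)

lemma japaneseBracket_le (ξ : Rn n) : japaneseBracket ξ ≤ 1 + ‖ξ‖ :=
  Real.sqrt_le_iff.2 ⟨by positivity, by nlinarith [norm_nonneg ξ]⟩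

lemma Symb.pd (h : Symb k θ m a) (i : Fin n) :
    Symb k θ (m - 1) (fun x => NonsmoothPDO.pd i (a x)) := by
  have := Bd.pd h i
  unfold Symb
  convert this using 4
  push_cast
  ring

lemma Symb.const_smul [NormedSpace ℂ F] [IsScalarTower ℝ ℂ F] (h : Symb k θ m a) (c : ℂ) :
    Symb k θ m (fun x ξ => c • a x ξ) := Bd.const_smul h c

lemma coord_smul_eq [NormedSpace ℂ F] [IsScalarTower ℝ ℂ F] (j : Fin n) (i : Fin n)
    {f : Rn n → F} (hf : Differentiable ℝ f) :
    pd i (fun ξ => ((ξ j : ℝ) : ℂ) • f ξ) =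
      fun ξ => (if i = j then (1 : ℂ) else 0) • f ξ + ((ξ j : ℝ) : ℂ) • pd i f ξ := by
  have hL : (fun ξ : Rn n => ((ξ j : ℝ) : ℂ)) =
    (Complex.ofRealCLM.comp (EuclideanSpace.proj j : Rn n →L[ℝ] ℝ)) := rfl
  rw [pd_smul (f := fun ξ : Rn n => ((ξ j : ℝ) : ℂ))
    (by rw [hL]; exact ContinuousLinearMap.differentiable _) hf]
  ext ξ
  congr 2
  rw [hL, NonsmoothPDO.pd, ContinuousLinearMap.fderiv]
  rcases eq_or_ne i j with rfl | hij
  · simp [unitVec]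
  · simp [unitVec, hij, hij.symm]

lemma contDiff_coord (j : Fin n) : ContDiff ℝ ∞ (fun ξ : Rn n => ((ξ j : ℝ) : ℂ)) :=
  (Complex.ofRealCLM.comp (EuclideanSpace.proj j : Rn n →L[ℝ] ℝ)).contDiff

/-- By Leibniz, `∂ᵢ(ξⱼ a)` is `δᵢⱼ a + ξⱼ ∂ᵢa`. Both terms have order `m`, so induction on the list
applies to `∂ᵢa` of order `m - 1`. -/
lemma Symb.coord_smul [NormedSpace ℂ F] [IsScalarTower ℝ ℂ F] (h : Symb k θ m a) (j : Fin n) :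
    Symb k θ (m + 1) (fun x ξ => ((ξ j : ℝ) : ℂ) • a x ξ) := by
  refine ⟨fun x => (contDiff_coord j).smul (h.1 x), fun l => ?_⟩
  induction l generalizing a m with
  | nil =>
    obtain ⟨C, hC, hb⟩ := h.2 []
    refine ⟨C, hC, fun ξ => ((hb ξ).const_smul ((ξ j : ℝ) : ℂ)).mono ?_⟩
    have hp := japaneseBracket_pos ξ
    have h1 : ‖((ξ j : ℝ) : ℂ)‖ ≤ japaneseBracket ξ := by
      rw [Complex.norm_real]
      exact (PiLp.norm_apply_le ξ j).trans (norm_le_japaneseBracket ξ)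
    have h2 : japaneseBracket ξ ^ (m + 1 - (0 : ℕ)) =
        japaneseBracket ξ * japaneseBracket ξ ^ (m - (0 : ℕ)) := by
      rw [show m + 1 - ((0 : ℕ) : ℝ) = 1 + (m - (0 : ℕ)) by ring, Real.rpow_add hp, Real.rpow_one]
    have h3 : 0 ≤ C * japaneseBracket ξ ^ (m - (0 : ℕ)) := by positivity
    simp only [List.length_nil]
    rw [h2]
    nlinarith
  | cons i l ih =>
    obtain ⟨C, hC, hb⟩ := h.2 l
    obtain ⟨C', hC', hb'⟩ := ih (h.pd i)
    refine ⟨‖(if i = j then (1 : ℂ) else 0)‖ * C + C', by positivity, fun ξ => ?_⟩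
    have e : (fun x => dl (i :: l) (fun ξ => ((ξ j : ℝ) : ℂ) • a x ξ) ξ) = fun x =>
        (if i = j then (1 : ℂ) else 0) • dl l (a x) ξ +
          dl l (fun ξ => ((ξ j : ℝ) : ℂ) • NonsmoothPDO.pd i (a x) ξ) ξ := by
      ext x
      have h1 : ContDiff ℝ ∞ (fun ξ => (if i = j then (1 : ℂ) else 0) • a x ξ) :=
        contDiff_const.smul (h.1 x)
      have h2 : ContDiff ℝ ∞ (fun ξ : Rn n => ((ξ j : ℝ) : ℂ) • NonsmoothPDO.pd i (a x) ξ) :=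
        (contDiff_coord j).smul (ContDiff.pd_infty (h.1 x) i)
      rw [dl_cons, coord_smul_eq j i (differentiable_of_smooth (h.1 x)), dl_add h1 h2,
        dl_const_smul _ (h.1 x)]
    rw [e]
    have e1 : m + 1 - ((i :: l).length : ℝ) = m - l.length := by
      simp only [List.length_cons]; push_cast; ring
    have e2 : m - 1 + 1 - (l.length : ℝ) = m - l.length := by ring
    simp only [e1, add_mul, mul_assoc]
    simp only [e2] at hb'
    exact ((hb ξ).const_smul _).add (hb' ξ)

lemma Symb.of_isCtauSymbol {τ : ℝ} (hp : IsCtauSymbol τ m a) :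
    Symb ⌊τ⌋₊ (τ - ⌊τ⌋₊) m a := by
  refine ⟨hp.1, fun l => ?_⟩
  obtain ⟨hmem, C, hC⟩ := hp.2 (fun i => l.count i)
  -- The constant in the symbol estimate is not assumed nonnegative.
  refine ⟨|C|, abs_nonneg _, fun ξ => ?_⟩
  have e : (fun x => dl l (a x) ξ) = fun x => partialDeriv (fun i => l.count i) (a x) ξ := by
    ext x
    exact dl_eq_partialDeriv l ((hp.1 x).of_le (by exact_mod_cast le_top)) ξ
  have hpos := japaneseBracket_pos ξ
  rw [e]
  refine HB.of_ctauNorm_le (hmem ξ).1 (by positivity) ((hC ξ).trans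
    (ENNReal.ofReal_le_ofReal ?_))
  rw [multiLength, sum_count]
  gcongr
  exact le_abs_self C

lemma IsCutoff.pd {H : Rn n → Rn n → ℂ} (h : IsCutoff k θ H) (i : Fin n) :
    IsCutoff k θ (fun x => NonsmoothPDO.pd i (H x)) := by
  refine ⟨h.1.pd i, fun x => ?_⟩
  have h0 : H x =ᶠ[𝓝 0] fun _ => 0 := h.2 x
  filter_upwards [h0.eventuallyEq_nhds] with z hz
  rw [NonsmoothPDO.pd, hz.fderiv_eq]
  simp

lemma pd_comp_const_sub {f : Rn n → ℂ} (hf : Differentiable ℝ f) (i : Fin n) (x : Rn n) :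
    pd i (fun z => f (x - z)) = fun z => (-1 : ℂ) • pd i f (x - z) := by
  ext z
  have := (hf (x - z)).hasFDerivAt.comp z ((hasFDerivAt_id z).const_sub x)
  simp only [pd]
  rw [HasFDerivAt.fderiv (f := fun z => f (x - z)) this]
  simp

lemma contDiff_comp_const_sub {f : Rn n → ℂ} (hf : ContDiff ℝ ∞ f) (x : Rn n) :
    ContDiff ℝ ∞ (fun z => f (x - z)) :=
  hf.comp (contDiff_const.sub contDiff_id)

lemma dl_comp_const_sub {f : Rn n → ℂ} (hf : ContDiff ℝ ∞ f) (l : List (Fin n)) (x : Rn n) :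
    dl l (fun z => f (x - z)) = fun z => (-1 : ℂ) ^ l.length • dl l f (x - z) := by
  induction l generalizing f with
  | nil => simp
  | cons i l ih =>
    have hs := ContDiff.pd_infty hf i
    rw [dl_cons, pd_comp_const_sub (differentiable_of_smooth hf),
      dl_const_smul _ (contDiff_comp_const_sub hs x), ih hs]
    ext z
    simp [pow_succ]

lemma MemCbInfty.dl_bound {f : Rn n → F} (h : MemCbInfty f) (l : List (Fin n)) :
    ∃ C, ∀ x, ‖dl l f x‖ ≤ C := by
  obtain ⟨C, hC⟩ := h.2 (fun i => l.count i)
  exact ⟨C, fun x => by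
    rw [dl_eq_partialDeriv l (h.1.of_le (by exact_mod_cast le_top))]; exact hC x⟩

/-- The function `φ(x) ψ(x - z)` is a cutoff function. -/
lemma isCutoff_mul {φ ψ : Rn n → ℂ} (hθ0 : 0 ≤ θ) (hθ1 : θ ≤ 1) (hφ : MemCbInfty φ)
    (hψ : MemCbInfty ψ) (hsupp : tsupport φ ∩ tsupport ψ = ∅) :
    IsCutoff k θ (fun x z => φ x * ψ (x - z)) := by
  refine ⟨⟨fun x => contDiff_const.mul (contDiff_comp_const_sub hψ.1 x),
    fun l => ?_⟩, fun x => ?_⟩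
  · obtain ⟨C, hC⟩ := HB.of_smooth hθ0 hθ1 hφ.1 hφ.dl_bound k
    obtain ⟨C', hC'⟩ := HB.of_smooth hθ0 hθ1 (ContDiff.dl_infty hψ.1 l)
      (fun l' => by rw [← dl_append]; exact hψ.dl_bound _) k
    obtain ⟨D, hD, h⟩ := HB.smul (F := ℂ) n k hθ0 hθ1
    have hC0 := hC.nonneg
    have hC0' := hC'.nonneg
    refine ⟨D * (C * C'), by positivity, fun z => ?_⟩
    have e : (fun x => dl l (fun z => φ x * ψ (x - z)) z) =
        fun x => φ x • ((-1 : ℂ) ^ l.length • dl l ψ (x - z)) := by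
      ext x
      have := congrFun (dl_const_smul (φ x)
        (contDiff_comp_const_sub hψ.1 x) l) z
      rw [dl_comp_const_sub hψ.1] at this
      exact this
    rw [e]
    refine (h hC ((hC'.comp_sub_const z).const_smul _)).mono (le_of_eq ?_)
    simp
  -- On the support of `φ` the point `x` lies off the closed support of `ψ`, so `ψ(x - z) = 0` for
  -- small `z`; elsewhere `φ(x) = 0`. No radius uniform in `x` is available or needed.
  · by_cases hx : x ∈ tsupport φ
    · have hx' : x ∉ tsupport ψ := fun hx' => by
        have : x ∈ tsupport φ ∩ tsupport ψ := ⟨hx, hx'⟩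
        simp [hsupp] at this
      have h0 : ∀ᶠ y in 𝓝 x, ψ y = 0 := notMem_tsupport_iff_eventuallyEq.1 hx'
      have ht : Tendsto (fun z => x - z) (𝓝 0) (𝓝 x) := by
        have : Continuous fun z : Rn n => x - z := by fun_prop
        simpa using this.tendsto 0
      filter_upwards [ht.eventually h0] with z hz
      rw [hz, mul_zero]
    · exact Eventually.of_forall fun z => by simp [image_eq_zero_of_notMem_tsupport hx]

end Classes

/-! ### Division of cutoff functions by coordinates -/

section Hadamard

variable {n : ℕ} {k : ℕ} {θ : ℝ}

/-- The weighted average `∫₀¹ tᴺ g(t z) dt`. -/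
def radialAverage (N : ℕ) (g : Rn n → ℂ) (z : Rn n) : ℂ :=
  ∫ t : unitInterval, ((t : ℝ) : ℂ) ^ N • g ((t : ℝ) • z)

lemma norm_unitInterval_pow_le (N : ℕ) (t : unitInterval) : ‖((t : ℝ) : ℂ) ^ N‖ ≤ 1 := by
  rw [norm_pow, Complex.norm_real, Real.norm_of_nonneg t.2.1]
  exact pow_le_one₀ t.2.1 t.2.2

lemma pd_comp_smul {g : Rn n → ℂ} (hg : Differentiable ℝ g) (i : Fin n) (t : ℝ) :
    pd i (fun z => g (t • z)) = fun z => (t : ℂ) • pd i g (t • z) := by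
  ext z
  have := (hg (t • z)).hasFDerivAt.comp z ((hasFDerivAt_id z).const_smul t)
  simp only [pd]
  rw [HasFDerivAt.fderiv (f := fun z => g (t • z)) this]
  simp

/-- Each derivative of `g(t z)` releases a factor `t`; the weight `tᴺ` keeps the family of averages
closed under differentiation. -/
lemma radialAverage_pd {g : Rn n → ℂ} (hg : ContDiff ℝ ∞ g)
    (hb : ∀ l : List (Fin n), ∃ C, ∀ z, ‖dl l g z‖ ≤ C) (N : ℕ) :
    ContDiff ℝ 1 (radialAverage N g) ∧
      ∀ i, pd i (radialAverage N g) = radialAverage (N + 1) (pd i g) := by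
  obtain ⟨C, hC⟩ := hb []
  choose D hD using fun i => hb [i]
  have hC0 : 0 ≤ C := (norm_nonneg _).trans (hC 0)
  have hD0 : ∀ i, 0 ≤ D i := fun i => (norm_nonneg _).trans (hD i 0)
  have hs : ∀ t : ℝ, ContDiff ℝ ∞ (fun z => g (t • z)) := fun t =>
    hg.comp (contDiff_const_smul t)
  have hpd : ∀ i (t : unitInterval), pd i (fun z => ((t : ℝ) : ℂ) ^ N • g ((t : ℝ) • z)) =
      fun z => ((t : ℝ) : ℂ) ^ (N + 1) • pd i g ((t : ℝ) • z) := fun i t => by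
    rw [pd_const_smul _ (differentiable_of_smooth (hs t)),
      pd_comp_smul (differentiable_of_smooth hg)]
    ext z
    simp only [smul_eq_mul]
    ring
  have hsum := Finset.sum_nonneg fun i (_ : i ∈ Finset.univ) => hD0 i
  obtain ⟨h1, h2⟩ := contDiff_one_integral (μ := (volume : Measure unitInterval))
    (g := fun z t => ((t : ℝ) : ℂ) ^ N • g ((t : ℝ) • z)) (b := fun _ => C + ∑ i, D i)
    (fun z => by
      have := hg.continuous
      exact Continuous.aestronglyMeasurable (by fun_prop))
    (fun t => ContDiff.of_le ((hs t).const_smul (((t : ℝ) : ℂ) ^ N) :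
      ContDiff ℝ ∞ fun z => ((t : ℝ) : ℂ) ^ N • g ((t : ℝ) • z)) (by simp))
    (fun z t => by
      rw [norm_smul]
      have := mul_le_mul (norm_unitInterval_pow_le N t) (hC ((t : ℝ) • z)) (norm_nonneg _)
        zero_le_one
      simp only [dl_nil] at this
      linarith)
    (fun i z t => by
      rw [hpd, norm_smul]
      have := mul_le_mul (norm_unitInterval_pow_le (N + 1) t) (hD i ((t : ℝ) • z)) (norm_nonneg _)
        zero_le_one
      simp only [dl_cons, dl_nil] at this
      linarith [Finset.single_le_sum (fun i _ => hD0 i) (Finset.mem_univ i)])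
    (integrable_const _)
  refine ⟨h1, fun i => (h2 i).trans ?_⟩
  ext z
  simp only [hpd]
  rfl

lemma radialAverage_dl {g : Rn n → ℂ} (hg : ContDiff ℝ ∞ g)
    (hb : ∀ l : List (Fin n), ∃ C, ∀ z, ‖dl l g z‖ ≤ C) (N : ℕ) (l : List (Fin n)) :
    dl l (radialAverage N g) = radialAverage (N + l.length) (dl l g) := by
  induction l generalizing g N with
  | nil => rfl
  | cons i l ih =>
    rw [dl_cons, (radialAverage_pd hg hb N).2 i,
      ih (ContDiff.pd_infty hg i) (fun l => hb (i :: l)), List.length_cons, dl_cons]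
    congr 1
    ring

lemma radialAverage_contDiff {g : Rn n → ℂ} (hg : ContDiff ℝ ∞ g)
    (hb : ∀ l : List (Fin n), ∃ C, ∀ z, ‖dl l g z‖ ≤ C) (N : ℕ) :
    ContDiff ℝ ∞ (radialAverage N g) := by
  refine contDiff_infty.2 fun K => ?_
  induction K generalizing g N with
  | zero => exact contDiff_zero.2 (radialAverage_pd hg hb N).1.continuous
  | succ K ih =>
    obtain ⟨h1, h2⟩ := radialAverage_pd hg hb N
    refine contDiff_succ_iff_pd.2 ⟨h1.differentiable (by simp), fun i => ?_⟩
    rw [h2]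
    exact ih (ContDiff.pd_infty hg i) (fun l => hb (i :: l)) _

/-- The `j`-th coefficient in `H(x, z) = ∑ zⱼ Hⱼ(x, z)`. -/
def hadamard (j : Fin n) (H : Rn n → Rn n → ℂ) (x : Rn n) : Rn n → ℂ :=
  radialAverage 0 (pd j (H x))

lemma IsCutoff.dl_bound {H : Rn n → Rn n → ℂ} (h : IsCutoff k θ H) (x : Rn n)
    (l : List (Fin n)) : ∃ C, ∀ z, ‖dl l (H x) z‖ ≤ C := by
  obtain ⟨C, -, hC⟩ := h.1.2 l
  exact ⟨C * 1, fun z => (hC z).bound x⟩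

/-- Since `|t| ≤ 1` on a probability space, averaging does not enlarge the bounds. Vanishing near
`0` survives because a ball around `0` contains `t z` along with `z`. -/
lemma IsCutoff.hadamard {H : Rn n → Rn n → ℂ} (h : IsCutoff k θ H) (j : Fin n) :
    IsCutoff k θ (hadamard j H) := by
  have hp := h.pd j
  refine ⟨⟨fun x => radialAverage_contDiff (hp.1.1 x) (hp.dl_bound x) 0, fun l => ?_⟩,
    fun x => ?_⟩
  · obtain ⟨C, hC, hb⟩ := hp.1.2 l
    refine ⟨C, hC, fun z => ?_⟩
    have e : (fun x => dl l (NonsmoothPDO.hadamard j H x) z) = fun x => ∫ t : unitInterval,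
        ((t : ℝ) : ℂ) ^ (0 + l.length) • dl l (NonsmoothPDO.pd j (H x)) ((t : ℝ) • z) := by
      ext x
      exact congrFun (radialAverage_dl (hp.1.1 x) (hp.dl_bound x) 0 l) z
    rw [e]
    refine (HB.integral (μ := (volume : Measure unitInterval)) (b := fun _ => C * 1)
      (fun x => ?_) (fun t => ?_) (integrable_const _)).mono (by simp)
    · have := (ContDiff.dl_infty (hp.1.1 x) l).continuous
      exact Continuous.aestronglyMeasurable (by fun_prop)
    · refine ((hb ((t : ℝ) • z)).const_smul _).mono ?_
      have := norm_unitInterval_pow_le (0 + l.length) t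
      nlinarith
  · obtain ⟨ε, hε, hz⟩ := Metric.eventually_nhds_iff_ball.1 (hp.2 x)
    refine Metric.eventually_nhds_iff_ball.2 ⟨ε, hε, fun z hzε => ?_⟩
    have : ∀ t : unitInterval, NonsmoothPDO.pd j (H x) ((t : ℝ) • z) = 0 := fun t => by
      refine hz _ ?_
      rw [mem_ball_zero_iff] at hzε ⊢
      refine lt_of_le_of_lt ?_ hzε
      rw [norm_smul, Real.norm_of_nonneg t.2.1]
      exact mul_le_of_le_one_left (norm_nonneg _) t.2.2
    simp [NonsmoothPDO.hadamard, radialAverage, this]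

/-- The fundamental theorem of calculus along the segment from `0` to `z`, using `H(x, 0) = 0`. -/
lemma IsCutoff.eq_sum_hadamard {H : Rn n → Rn n → ℂ} (h : IsCutoff k θ H) (x z : Rn n) :
    H x z = ∑ j, ((z j : ℝ) : ℂ) • NonsmoothPDO.hadamard j H x z := by
  have h0 : H x 0 = 0 := (h.2 x).self_of_nhds
  have hs := h.1.1 x
  have hpc : ∀ j, Continuous (NonsmoothPDO.pd j (H x)) := fun j =>
    (ContDiff.pd_infty hs j).continuous
  have hderiv : ∀ t : ℝ, HasDerivAt (fun t : ℝ => H x (t • z))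
      (∑ j, ((z j : ℝ) : ℂ) • NonsmoothPDO.pd j (H x) (t • z)) t := fun t => by
    have h1 := (differentiable_of_smooth hs (t • z)).hasFDerivAt.comp_hasDerivAt t
      ((hasDerivAt_id t).smul_const z)
    convert! h1 using 1
    rw [clm_eq_sum]
    simp [NonsmoothPDO.pd]
  have hFTC := intervalIntegral.integral_eq_sub_of_hasDerivAt (a := 0) (b := 1)
    (fun t _ => hderiv t) (Continuous.intervalIntegrable (by fun_prop) _ _)
  simp only [one_smul, zero_smul, h0, sub_zero] at hFTC
  rw [← hFTC, intervalIntegral.integral_finsetSum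
    (fun j _ => Continuous.intervalIntegrable (by fun_prop) _ _)]
  refine Finset.sum_congr rfl fun j _ => ?_
  rw [intervalIntegral.integral_smul]
  congr 1
  rw [NonsmoothPDO.hadamard, radialAverage, intervalIntegral.integral_of_le zero_le_one,
    ← integral_Icc_eq_integral_Ioc]
  simp only [pow_zero, one_smul]
  exact (integral_subtype_comap measurableSet_Icc
    (fun t : ℝ => NonsmoothPDO.pd j (H x) (t • z))).symm

end Hadamard

/-! ### Oscillatory integrals of symbols of order below `-n`. -/

/-- The oscillating factor `e^{i z·ξ}`. -/
def osc {n : ℕ} (z ξ : Rn n) : ℂ := Complex.exp (Complex.I * (inner ℝ z ξ : ℝ))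

/-- The function `q(x, z) = ∫ e^{i z·ξ} a(x, ξ) dξ`. -/
def oscInt {n : ℕ} {F : Type*} [NormedAddCommGroup F] [NormedSpace ℝ F] [NormedSpace ℂ F]
    (a : Rn n → Rn n → F) (x z : Rn n) : F :=
  ∫ ξ, osc z ξ • a x ξ

section Osc

variable {n : ℕ}

lemma norm_osc (z ξ : Rn n) : ‖osc z ξ‖ = 1 := by
  rw [osc, mul_comm, Complex.norm_exp_ofReal_mul_I]

lemma osc_comm (z ξ : Rn n) : osc z ξ = osc ξ z := by
  rw [osc, osc, real_inner_comm]

lemma contDiff_osc (ξ : Rn n) : ContDiff ℝ ∞ (fun z => osc z ξ) := by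
  have : ContDiff ℝ ∞ fun z : Rn n => ((inner ℝ z ξ : ℝ) : ℂ) :=
    Complex.ofRealCLM.contDiff.comp (contDiff_id.inner ℝ contDiff_const)
  exact (contDiff_const.mul this).cexp

lemma contDiff_osc' (z : Rn n) : ContDiff ℝ ∞ (osc z) := by
  have : osc z = fun ξ => osc ξ z := funext fun ξ => osc_comm z ξ
  rw [this]
  exact contDiff_osc z

lemma continuous_osc : Continuous fun p : Rn n × Rn n => osc p.1 p.2 := by
  unfold osc
  have : Continuous fun p : Rn n × Rn n => (inner ℝ p.1 p.2 : ℝ) := continuous_inner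
  fun_prop

lemma pd_osc (ξ : Rn n) (j : Fin n) :
    pd j (fun z => osc z ξ) = fun z => osc z ξ * (Complex.I * ((ξ j : ℝ) : ℂ)) := by
  ext z
  have h1 : HasFDerivAt (fun z : Rn n => (inner ℝ z ξ : ℝ)) (innerSL ℝ ξ) z := by
    have := (innerSL ℝ ξ).hasFDerivAt (x := z)
    simpa [real_inner_comm] using this
  have h2 := ((Complex.ofRealCLM.hasFDerivAt.comp z h1).const_mul Complex.I).cexp
  rw [pd, HasFDerivAt.fderiv (f := fun z => osc z ξ) h2]
  simp [osc, unitVec, EuclideanSpace.inner_single_right]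

lemma pd_osc' (z : Rn n) (j : Fin n) :
    pd j (osc z) = fun ξ => osc z ξ * (Complex.I * ((z j : ℝ) : ℂ)) := by
  have : osc z = fun ξ => osc ξ z := funext fun ξ => osc_comm z ξ
  rw [this, pd_osc]

lemma integrable_japaneseBracket {m : ℝ} (hm : m < -n) :
    Integrable (fun ξ : Rn n => japaneseBracket ξ ^ m) := by
  have h := integrable_rpow_neg_one_add_norm_sq (E := Rn n) (μ := volume) (r := -m)
    (by rw [finrank_euclideanSpace_fin]; linarith)
  refine h.congr (Eventually.of_forall fun ξ => ?_)
  simp only [japaneseBracket]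
  rw [Real.sqrt_eq_rpow, ← Real.rpow_mul (by positivity)]
  congr 1
  ring

end Osc

section OscInt

variable {n : ℕ} {F : Type*} [NormedAddCommGroup F] [NormedSpace ℝ F] [NormedSpace ℂ F]
  [IsScalarTower ℝ ℂ F] {k : ℕ} {θ m : ℝ} {a : Rn n → Rn n → F}

lemma Symb.bound (h : Symb k θ m a) : ∃ C, 0 ≤ C ∧
    ∀ ξ, HB k θ (C * japaneseBracket ξ ^ m) (fun x => a x ξ) := by
  obtain ⟨C, hC, hb⟩ := h.2 []
  exact ⟨C, hC, by simpa using hb⟩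

lemma Symb.continuous (h : Symb k θ m a) (x : Rn n) : Continuous (a x) := (h.1 x).continuous

lemma continuous_osc_smul (h : Symb k θ m a) (x z : Rn n) :
    Continuous fun ξ => osc z ξ • a x ξ :=
  (contDiff_osc' z).continuous.smul (h.continuous x)

lemma Symb.integrable_osc_smul (h : Symb k θ m a) (hm : m < -n) (x z : Rn n) :
    Integrable fun ξ => osc z ξ • a x ξ := by
  obtain ⟨C, hC, hb⟩ := h.bound
  refine ((integrable_japaneseBracket hm).const_mul C).mono'
    (continuous_osc_smul h x z).aestronglyMeasurable (ae_of_all _ fun ξ => ?_)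
  rw [norm_smul, norm_osc, one_mul]
  exact (hb ξ).bound x

lemma HB_oscInt (h : Symb k θ m a) (hm : m < -n) :
    ∃ C, 0 ≤ C ∧ ∀ z, HB k θ C (fun x => oscInt a x z) := by
  obtain ⟨C, hC, hb⟩ := h.bound
  have key : ∀ z, HB k θ (∫ ξ : Rn n, C * japaneseBracket ξ ^ m) (fun x => oscInt a x z) :=
    fun z => HB.integral (fun x => (continuous_osc_smul h x z).aestronglyMeasurable)
      (fun ξ => by simpa [norm_osc] using (hb ξ).const_smul (osc z ξ))
      ((integrable_japaneseBracket hm).const_mul C)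
  exact ⟨_, (key 0).nonneg, key⟩

lemma continuous_oscInt (h : Symb k θ m a) (hm : m < -n) (x : Rn n) :
    Continuous (oscInt a x) := by
  obtain ⟨C, hC, hb⟩ := h.bound
  refine continuous_of_dominated (bound := fun ξ => C * japaneseBracket ξ ^ m)
    (fun z => (continuous_osc_smul h x z).aestronglyMeasurable)
    (fun z => ae_of_all _ fun ξ => ?_) ((integrable_japaneseBracket hm).const_mul C)
    (ae_of_all _ fun ξ => (contDiff_osc ξ).continuous.smul continuous_const)
  rw [norm_smul, norm_osc, one_mul]
  exact (hb ξ).bound x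

/-- Differentiation in `z` produces `i ξⱼ`, raising the order by one; `C ⟨ξ⟩^{m+1}` dominates both
the integrand and its derivatives. -/
lemma pd_oscInt (h : Symb k θ m a) (hm : m + 1 < -n) (x : Rn n) :
    ContDiff ℝ 1 (oscInt a x) ∧ ∀ j, pd j (oscInt a x) =
      oscInt (fun x ξ => Complex.I • ((ξ j : ℝ) : ℂ) • a x ξ) x := by
  obtain ⟨C, hC, hb⟩ := h.bound
  have hpd : ∀ j ξ, pd j (fun z => osc z ξ • a x ξ) =
      fun z => osc z ξ • Complex.I • ((ξ j : ℝ) : ℂ) • a x ξ := fun j ξ => by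
    rw [pd_smul (g := fun _ => a x ξ) (differentiable_of_smooth (contDiff_osc ξ))
      (differentiable_const _), pd_osc]
    ext z
    have : pd j (fun _ => a x ξ) z = 0 := by simp [pd]
    rw [this, smul_zero, add_zero, mul_smul, mul_smul]
  obtain ⟨h1, h2⟩ := contDiff_one_integral (μ := volume)
    (g := fun z ξ => osc z ξ • a x ξ) (b := fun ξ => C * japaneseBracket ξ ^ (m + 1))
    (fun z => (continuous_osc_smul h x z).aestronglyMeasurable)
    (fun ξ => ((contDiff_osc ξ).of_le (by simp)).smul contDiff_const)
    (fun z ξ => by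
      rw [norm_smul, norm_osc, one_mul]
      refine ((hb ξ).bound x).trans ?_
      gcongr
      · exact one_le_japaneseBracket ξ
      · linarith)
    (fun j z ξ => by
      rw [hpd, norm_smul, norm_osc, one_mul, norm_smul, Complex.norm_I, one_mul, norm_smul,
        Complex.norm_real, Real.rpow_add (japaneseBracket_pos ξ), Real.rpow_one]
      calc ‖ξ j‖ * ‖a x ξ‖ ≤ japaneseBracket ξ * (C * japaneseBracket ξ ^ m) :=
            mul_le_mul ((PiLp.norm_apply_le ξ j).trans (norm_le_japaneseBracket ξ))
              ((hb ξ).bound x) (norm_nonneg _) (japaneseBracket_pos ξ).le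
        _ = C * (japaneseBracket ξ ^ m * japaneseBracket ξ) := by ring)
    ((integrable_japaneseBracket hm).const_mul C)
  refine ⟨h1, fun j => (h2 j).trans ?_⟩
  ext z
  simp only [hpd]
  rfl

/-- Since `∂_{ξⱼ} e^{i z·ξ} = i zⱼ e^{i z·ξ}`, integration by parts moves `zⱼ` onto the symbol.
Integrability of all products involved excludes boundary terms. -/
lemma coord_smul_oscInt (h : Symb k θ m a) (hm : m < -n) (x z : Rn n) (j : Fin n) :
    ((z j : ℝ) : ℂ) • oscInt a x z =
      oscInt (fun x ξ => Complex.I • pd j (a x) ξ) x z := by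
  have hp := h.pd j
  have e : ∀ ξ, fderiv ℝ (osc z) ξ (unitVec j) = (Complex.I * ((z j : ℝ) : ℂ)) * osc z ξ :=
    fun ξ => (congrFun (pd_osc' z j) ξ).trans (mul_comm _ _)
  have hi := h.integrable_osc_smul hm x z
  have key := integral_smul_fderiv_eq_neg_fderiv_smul_of_integrable (μ := volume)
    (f := osc z) (g := a x) (v := unitVec j)
    (by
      simp only [e, mul_smul]
      exact (hi.smul ((z j : ℝ) : ℂ)).smul Complex.I)
    (hp.integrable_osc_smul (by linarith) x z) hi
    (fun ξ _ => differentiable_of_smooth (contDiff_osc' z) ξ)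
    (fun ξ _ => differentiable_of_smooth (h.1 x) ξ)
  simp only [e, mul_smul] at key
  rw [integral_smul, integral_smul] at key
  have : oscInt (fun x ξ => Complex.I • pd j (a x) ξ) x z =
      Complex.I • ∫ ξ, osc z ξ • fderiv ℝ (a x) ξ (unitVec j) := by
    rw [← integral_smul]
    exact integral_congr_ae (ae_of_all _ fun ξ => smul_comm _ _ _)
  rw [this, key, smul_neg, ← mul_smul, Complex.I_mul_I, neg_one_smul, neg_neg]
  rfl

end OscInt

/-! ### Kernels with bounded moments and derivatives -/

/-- `K(x, z)` has `L` orders of derivatives and moments in `z` that are bounded in a Hölder class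
with respect to `x`. -/
def Good {n : ℕ} {F : Type*} [NormedAddCommGroup F] [NormedSpace ℝ F] [NormedSpace ℂ F]
    (k : ℕ) (θ : ℝ) (L : ℕ) (K : Rn n → Rn n → F) : Prop :=
  match L with
  | 0 => (∀ x, Continuous (K x)) ∧ ∃ C, ∀ z, HB k θ C (fun x => K x z)
  | L + 1 => ((∀ x, ContDiff ℝ 1 (K x)) ∧ ∃ C, ∀ z, HB k θ C (fun x => K x z)) ∧
      ∀ j, Good k θ L (fun x => pd j (K x)) ∧ Good k θ L (fun x z => ((z j : ℝ) : ℂ) • K x z)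

section Kernel

variable {n : ℕ} {F : Type*} [NormedAddCommGroup F] [NormedSpace ℝ F] [NormedSpace ℂ F]
  [IsScalarTower ℝ ℂ F] {k L : ℕ} {θ m : ℝ} {K K' : Rn n → Rn n → F}

lemma Good.bound (h : Good k θ L K) : ∃ C, ∀ z, HB k θ C (fun x => K x z) := by
  cases L with
  | zero => exact h.2
  | succ L => exact h.1.2

lemma Good.contDiff (h : Good k θ L K) (x : Rn n) : ContDiff ℝ L (K x) := by
  induction L generalizing K with
  | zero => exact contDiff_zero.2 (h.1 x)
  | succ L ih =>
    exact contDiff_succ_iff_pd.2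
      ⟨(h.1.1 x).differentiable (by simp), fun j => ih (h.2 j).1⟩

lemma Good.add (h : Good k θ L K) (h' : Good k θ L K') :
    Good k θ L (fun x z => K x z + K' x z) := by
  obtain ⟨C, hC⟩ := h.bound
  obtain ⟨C', hC'⟩ := h'.bound
  have hb : ∃ C, ∀ z, HB k θ C (fun x => K x z + K' x z) := ⟨_, fun z => (hC z).add (hC' z)⟩
  induction L generalizing K K' C C' with
  | zero => exact ⟨fun x => (h.1 x).add (h'.1 x), hb⟩
  | succ L ih =>
    refine ⟨⟨fun x => (h.1.1 x).add (h'.1.1 x), hb⟩, fun j => ⟨?_, ?_⟩⟩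
    · obtain ⟨D, hD⟩ := (h.2 j).1.bound
      obtain ⟨D', hD'⟩ := (h'.2 j).1.bound
      have := ih (h.2 j).1 (h'.2 j).1 D hD D' hD' ⟨_, fun z => (hD z).add (hD' z)⟩
      convert this using 2 with x
      exact pd_add ((h.1.1 x).differentiable (by simp)) ((h'.1.1 x).differentiable (by simp)) j
    · obtain ⟨D, hD⟩ := (h.2 j).2.bound
      obtain ⟨D', hD'⟩ := (h'.2 j).2.bound
      have := ih (h.2 j).2 (h'.2 j).2 D hD D' hD' ⟨_, fun z => (hD z).add (hD' z)⟩
      simpa only [smul_add] using this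

lemma Good.zero : Good k θ L (fun _ _ : Rn n => (0 : F)) := by
  have hb : ∃ C, ∀ _z : Rn n, HB k θ C (fun _ : Rn n => (0 : F)) := ⟨0, fun _ => HB.zero⟩
  induction L with
  | zero => exact ⟨fun _ => continuous_const, hb⟩
  | succ L ih =>
    refine ⟨⟨fun _ => contDiff_const, hb⟩, fun j => ⟨?_, ?_⟩⟩
    · simpa only [pd_zero] using ih
    · simpa only [smul_zero] using ih

lemma Good.sum {ι : Type*} (s : Finset ι) {K : ι → Rn n → Rn n → F}
    (h : ∀ j ∈ s, Good k θ L (K j)) : Good k θ L (fun x z => ∑ j ∈ s, K j x z) := by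
  classical
  induction s using Finset.induction_on with
  | empty => simpa using Good.zero
  | insert a s ha ih =>
    simp only [Finset.sum_insert ha]
    exact (h a (by simp)).add (ih fun j hj => h j (by simp [hj]))

lemma HB_smul_oscInt (hθ0 : 0 ≤ θ) (hθ1 : θ ≤ 1) {H : Rn n → Rn n → ℂ}
    (hH : IsCutoff k θ H) {a : Rn n → Rn n → F} (ha : Symb k θ m a) (hm : m < -n) :
    ∃ C, ∀ z, HB k θ C (fun x => H x z • oscInt a x z) := by
  obtain ⟨C, hC, hbH⟩ := hH.1.2 []
  obtain ⟨C', hC', hbq⟩ := HB_oscInt ha hm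
  obtain ⟨D, hD, hs⟩ := HB.smul (F := F) n k hθ0 hθ1
  exact ⟨_, fun z => hs (hbH z) (hbq z)⟩

/-- A `z`-derivative falls on `H`, which remains a cutoff, or on the integral, where it costs one
order; a moment lowers the order. Hence `L` such operations need only `m + L < -n`. -/
lemma good_smul_oscInt (hθ0 : 0 ≤ θ) (hθ1 : θ ≤ 1) {H : Rn n → Rn n → ℂ}
    (hH : IsCutoff k θ H) {a : Rn n → Rn n → F} (ha : Symb k θ m a) (hm : m + L < -n) :
    Good k θ L (fun x z => H x z • oscInt a x z) := by
  have hm0 : m < -n := by linarith [(Nat.cast_nonneg L : (0 : ℝ) ≤ L)]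
  have hb := HB_smul_oscInt hθ0 hθ1 hH ha hm0
  induction L generalizing H a m with
  | zero =>
    exact ⟨fun x => (hH.1.1 x).continuous.smul (continuous_oscInt ha hm0 x), hb⟩
  | succ L ih =>
    push_cast at hm
    have hL := (Nat.cast_nonneg L : (0 : ℝ) ≤ L)
    have hq := fun x => pd_oscInt ha (by linarith) x
    refine ⟨⟨fun x => ((hH.1.1 x).of_le (by simp)).smul (hq x).1, hb⟩, fun j => ⟨?_, ?_⟩⟩
    · have hξ := (ha.coord_smul j).const_smul Complex.I
      have h1 := ih (hH.pd j) ha (by linarith) (by linarith)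
        (HB_smul_oscInt hθ0 hθ1 (hH.pd j) ha (by linarith))
      have h2 := ih hH hξ (by linarith) (by linarith)
        (HB_smul_oscInt hθ0 hθ1 hH hξ (by linarith))
      convert h1.add h2 using 2 with x
      rw [pd_smul (differentiable_of_smooth (hH.1.1 x)) ((hq x).1.differentiable (by simp)),
        (hq x).2]
    · have hξ := (ha.pd j).const_smul Complex.I
      have h1 := ih hH hξ (by linarith) (by linarith)
        (HB_smul_oscInt hθ0 hθ1 hH hξ (by linarith))
      convert h1 using 3 with x z
      rw [smul_comm, coord_smul_oscInt ha (by linarith)]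

/-- The kernel of the operator with amplitude `H(x, x - y) p(x, ξ)`, obtained from `N`
integrations by parts. -/
def kern {n : ℕ} {F : Type*} [NormedAddCommGroup F] [NormedSpace ℝ F] [NormedSpace ℂ F]
    (N : ℕ) (H : Rn n → Rn n → ℂ) (p : Rn n → Rn n → F) (x z : Rn n) : F :=
  match N with
  -- The Bochner integral takes the value `0` on nonintegrable functions, so this is the intended
  -- kernel only once the symbol has order below `-n`.
  | 0 => H x z • oscInt p x z
  | N + 1 => ∑ j, kern N (hadamard j H) (fun x ξ => Complex.I • pd j (p x) ξ) x z

lemma good_kern (hθ0 : 0 ≤ θ) (hθ1 : θ ≤ 1) {H : Rn n → Rn n → ℂ} (hH : IsCutoff k θ H)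
    {p : Rn n → Rn n → F} (hp : Symb k θ m p) (N : ℕ) (hm : m + L < -n + N) :
    Good k θ L (kern N H p) := by
  induction N generalizing H p m with
  | zero => exact good_smul_oscInt hθ0 hθ1 hH hp (by simpa using hm)
  | succ N ih =>
    push_cast at hm
    exact Good.sum _ fun j _ =>
      ih (hH.hadamard j) ((hp.pd j).const_smul Complex.I) (by linarith)

/-- Once the integrals converge, another round only rewrites `H` as `∑ zⱼ Hⱼ` and absorbs `zⱼ` by
`coord_smul_oscInt`. -/
lemma kern_succ {H : Rn n → Rn n → ℂ} (hH : IsCutoff k θ H)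
    {p : Rn n → Rn n → F} (hp : Symb k θ m p) (N : ℕ) (hm : m < -n + N) :
    kern (N + 1) H p = kern N H p := by
  induction N generalizing H p m with
  | zero =>
    ext x z
    simp only [kern]
    conv_rhs => rw [hH.eq_sum_hadamard x z, Finset.sum_smul]
    refine Finset.sum_congr rfl fun j _ => ?_
    rw [← coord_smul_oscInt hp (by simpa using hm), smul_assoc, smul_comm]
  | succ N ih =>
    ext x z
    push_cast at hm
    rw [kern, kern]
    exact Finset.sum_congr rfl fun j _ => congrFun (congrFun
      (ih (hH.hadamard j) ((hp.pd j).const_smul Complex.I) (by linarith)) x) z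

/-- After sufficiently many integrations by parts the kernel has bounded derivatives and moments
of all orders. -/
lemma good_kern_all (hθ0 : 0 ≤ θ) (hθ1 : θ ≤ 1) {H : Rn n → Rn n → ℂ} (hH : IsCutoff k θ H)
    {p : Rn n → Rn n → F} (hp : Symb k θ m p) (N : ℕ) (hm : m < -n + N) (L : ℕ) :
    Good k θ L (kern N H p) := by
  have key : ∀ M, kern (N + M) H p = kern N H p := fun M => by
    induction M with
    | zero => rfl
    | succ M ih =>
      rw [← ih, ← add_assoc]
      refine kern_succ hH hp _ ?_
      push_cast
      linarith [(Nat.cast_nonneg M : (0 : ℝ) ≤ M)]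
  -- The `L` additional rounds pay for the `L` derivatives and moments.
  rw [← key L]
  refine good_kern hθ0 hθ1 hH hp _ ?_
  push_cast
  linarith

lemma Good.dl (l : List (Fin n)) (h : Good k θ (L + l.length) K) :
    Good k θ L (fun x => NonsmoothPDO.dl l (K x)) := by
  induction l generalizing K with
  | nil => exact h
  | cons i l ih => exact ih (h.2 i).1

lemma Good.prod_smul (l : List (Fin n)) (h : Good k θ (L + l.length) K) :
    Good k θ L (fun x z => (((l.map fun i => z i).prod : ℝ) : ℂ) • K x z) := by
  induction l generalizing K with
  | nil => simpa using h
  | cons i l ih =>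
    have := ih (h.2 i).2
    simpa [mul_comm, mul_smul] using this

lemma prod_multiList (β : Fin n → ℕ) (z : Rn n) :
    ((multiList β).map fun i => z i).prod = monomialPow β z := by
  have : ∀ l : List (Fin n), (l.map fun i => z i).prod = ∏ i, z i ^ l.count i := fun l => by
    induction l with
    | nil => simp
    | cons j l ih =>
      rw [List.map_cons, List.prod_cons, ih]
      simp only [List.count_cons, pow_add, Finset.prod_mul_distrib, beq_iff_eq]
      rw [mul_comm]
      simp
  rw [this, monomialPow]
  simp only [count_multiList]

lemma Good.ctau {τ : ℝ} (h : ∀ L, Good ⌊τ⌋₊ (τ - ⌊τ⌋₊) L K) (α β : Fin n → ℕ) :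
    (∀ z, MemCtau τ (fun x => monomialPow β z • partialDeriv α (K x) z)) ∧
    ∃ C : ℝ, ∀ z,
      ctauNorm τ (fun x => monomialPow β z • partialDeriv α (K x) z) ≤ ENNReal.ofReal C := by
  -- The level left to unification is `0 + |β| + |α|`: derivatives are taken first, then moments.
  obtain ⟨C, hC⟩ := (Good.prod_smul (L := 0) (multiList β)
    (Good.dl (multiList α) (h _))).bound
  have e : ∀ z, (fun x => monomialPow β z • partialDeriv α (K x) z) = fun x =>
      ((((multiList β).map fun i => z i).prod : ℝ) : ℂ) •
        NonsmoothPDO.dl (multiList α) (K x) z := fun z => by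
    ext x
    rw [prod_multiList, partialDeriv_eq_dl α ((h _).contDiff x)]
    exact (algebraMap_smul ℂ (monomialPow β z) _).symm
  obtain ⟨N, hN⟩ := ctauNorm_le_of_HB (F := F) n τ
  refine ⟨fun z => ?_, N * C, fun z => ?_⟩
  · rw [e]
    exact (hC z).memCtau
  · rw [e]
    exact hN (hC z)

end Kernel

/-! ### Temperate growth, required for multiplying Schwartz functions. -/

section Growth

variable {n : ℕ} {F : Type*} [NormedAddCommGroup F] [NormedSpace ℝ F] {k : ℕ} {θ m : ℝ}

lemma iteratedFDeriv_growth {f : Rn n → F} (hf : ContDiff ℝ ∞ f)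
    (hb : ∀ l : List (Fin n), ∃ (N : ℕ) (C : ℝ), 0 ≤ C ∧ ∀ x, ‖dl l f x‖ ≤ C * (1 + ‖x‖) ^ N)
    (K : ℕ) : ∃ (N : ℕ) (C : ℝ), 0 ≤ C ∧
      ∀ x, ‖iteratedFDeriv ℝ K f x‖ ≤ C * (1 + ‖x‖) ^ N := by
  induction K generalizing f with
  | zero => simpa using hb []
  | succ K ih =>
    choose N C hC h using fun i => ih (ContDiff.pd_infty hf i) (fun l => hb (i :: l))
    let A : Fin n → F →L[ℝ] (Rn n →L[ℝ] F) := fun i =>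
      ContinuousLinearMap.smulRightL ℝ (Rn n) F (EuclideanSpace.proj i)
    refine ⟨∑ i, N i, ∑ i, ‖A i‖ * C i,
      Finset.sum_nonneg fun i _ => mul_nonneg (ContinuousLinearMap.opNorm_nonneg _) (hC i), fun x => ?_⟩
    have e : fderiv ℝ f = fun x => ∑ i, (A i ∘ pd i f) x := funext fun x => fderiv_eq_sum_pd f x
    have hs : ∀ i, ContDiff ℝ K (pd i f) := fun i => contDiff_infty.1 (ContDiff.pd_infty hf i) K
    rw [← norm_iteratedFDeriv_fderiv, e, iteratedFDeriv_fun_sum_apply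
      (fun i _ => ((A i).contDiff.comp (hs i)).contDiffAt), Finset.sum_mul]
    refine norm_sum_le_of_le _ fun i _ => ?_
    have h1 : (1 : ℝ) ≤ 1 + ‖x‖ := by linarith [norm_nonneg x]
    calc ‖iteratedFDeriv ℝ K (A i ∘ pd i f) x‖ ≤ ‖A i‖ * ‖iteratedFDeriv ℝ K (pd i f) x‖ :=
          (A i).norm_iteratedFDeriv_comp_left (hs i).contDiffAt le_rfl
      _ ≤ ‖A i‖ * (C i * (1 + ‖x‖) ^ N i) := by gcongr; exact h i x
      _ ≤ ‖A i‖ * (C i * (1 + ‖x‖) ^ (∑ i, N i)) := by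
          have := hC i
          gcongr
          · exact Finset.single_le_sum (fun i _ => Nat.zero_le _) (Finset.mem_univ i)
      _ = ‖A i‖ * C i * (1 + ‖x‖) ^ (∑ i, N i) := by ring

lemma hasTemperateGrowth_of_dl {f : Rn n → F} (hf : ContDiff ℝ ∞ f)
    (hb : ∀ l : List (Fin n), ∃ (N : ℕ) (C : ℝ), 0 ≤ C ∧ ∀ x, ‖dl l f x‖ ≤ C * (1 + ‖x‖) ^ N) :
    f.HasTemperateGrowth :=
  ⟨hf, fun K => by
    obtain ⟨N, C, -, h⟩ := iteratedFDeriv_growth hf hb K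
    exact ⟨N, C, h⟩⟩

lemma Symb.hasTemperateGrowth {a : Rn n → Rn n → F} (h : Symb k θ m a) (x : Rn n) :
    (a x).HasTemperateGrowth := by
  refine hasTemperateGrowth_of_dl (h.1 x) fun l => ?_
  obtain ⟨C, hC, hb⟩ := h.2 l
  refine ⟨⌈|m - l.length|⌉₊, C, hC, fun ξ => ((hb ξ).bound x).trans ?_⟩
  have h1 := one_le_japaneseBracket ξ
  gcongr
  calc japaneseBracket ξ ^ (m - l.length)
      ≤ japaneseBracket ξ ^ ((⌈|m - l.length|⌉₊ : ℕ) : ℝ) :=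
        Real.rpow_le_rpow_of_exponent_le h1 ((le_abs_self _).trans (Nat.le_ceil _))
    _ = japaneseBracket ξ ^ ⌈|m - l.length|⌉₊ := Real.rpow_natCast _ _
    _ ≤ (1 + ‖ξ‖) ^ ⌈|m - l.length|⌉₊ := by
        gcongr
        exact japaneseBracket_le ξ

lemma IsCutoff.hasTemperateGrowth {H : Rn n → Rn n → ℂ} (h : IsCutoff k θ H) (x : Rn n) :
    (H x).HasTemperateGrowth := by
  refine hasTemperateGrowth_of_dl (h.1.1 x) fun l => ?_
  obtain ⟨C, hC⟩ := h.dl_bound x l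
  exact ⟨0, C, (norm_nonneg _).trans (hC 0), by simpa using hC⟩

lemma hasTemperateGrowth_coord (j : Fin n) :
    (fun ξ : Rn n => ((ξ j : ℝ) : ℂ)).HasTemperateGrowth :=
  (Complex.ofRealCLM.comp (EuclideanSpace.proj j : Rn n →L[ℝ] ℝ)).hasTemperateGrowth

end Growth

/-! ### The kernel represents the operator. -/

section Representation

variable {n : ℕ} {X₀ X₁ : Type*} [NormedAddCommGroup X₀] [NormedSpace ℂ X₀]
  [NormedAddCommGroup X₁] [NormedSpace ℂ X₁] {k : ℕ} {θ m : ℝ}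

/-- The function `ξ ↦ ∫ e^{i z·ξ} v(z) dz` as a Schwartz function. -/
def schwartzOsc (v : 𝓢(Rn n, X₀)) : 𝓢(Rn n, X₀) :=
  SchwartzMap.compCLMOfContinuousLinearEquiv ℂ
    (ContinuousLinearEquiv.smulLeft (Units.mk0 ((2 * Real.pi)⁻¹ : ℝ) (by positivity))) (𝓕⁻ v)

/-- The dilation by `(2π)⁻¹` removes the `2π` from the phase of `𝓕⁻`. -/
lemma schwartzOsc_apply (v : 𝓢(Rn n, X₀)) (ξ : Rn n) :
    schwartzOsc v ξ = ∫ z, osc z ξ • v z := by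
  have : schwartzOsc v ξ = 𝓕⁻ (v : Rn n → X₀) ((2 * Real.pi)⁻¹ • ξ) := by
    rw [← SchwartzMap.fourierInv_coe]
    rfl
  rw [this, Real.fourierInv_eq']
  refine integral_congr_ae (ae_of_all _ fun z => ?_)
  simp only [osc, inner_smul_right]
  congr 2
  rw [mul_inv_cancel_left₀ (by positivity), mul_comm]

lemma integrable_osc_schwartz (v : 𝓢(Rn n, X₀)) (ξ : Rn n) :
    Integrable fun z => osc z ξ • v z :=
  (v.integrable (μ := volume)).norm.mono'
    ((contDiff_osc ξ).continuous.smul v.continuous).aestronglyMeasurable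
    (ae_of_all _ fun z => by rw [norm_smul, norm_osc, one_mul])

/-- Multiplication by `zⱼ`. -/
def coordMul (j : Fin n) (v : 𝓢(Rn n, X₀)) : 𝓢(Rn n, X₀) :=
  SchwartzMap.smulLeftCLM X₀ (fun ξ : Rn n => ((ξ j : ℝ) : ℂ)) v

lemma coordMul_apply (j : Fin n) (v : 𝓢(Rn n, X₀)) (z : Rn n) :
    coordMul j v z = ((z j : ℝ) : ℂ) • v z :=
  SchwartzMap.smulLeftCLM_apply_apply (hasTemperateGrowth_coord j) v z

lemma pd_schwartzOsc (v : 𝓢(Rn n, X₀)) (j : Fin n) (ξ : Rn n) :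
    pd j (schwartzOsc v) ξ = Complex.I • schwartzOsc (coordMul j v) ξ := by
  have e : (schwartzOsc v : Rn n → X₀) = fun ξ => ∫ z, osc z ξ • v z :=
    funext (schwartzOsc_apply v)
  have hpd : ∀ i z, pd i (fun ξ => osc z ξ • v z) =
      fun ξ => osc z ξ • Complex.I • coordMul i v z := fun i z => by
    rw [pd_smul (g := fun _ => v z) (differentiable_of_smooth (contDiff_osc' z))
      (differentiable_const _)]
    have e : pd i (fun ξ => osc z ξ) = _ := pd_osc' z i
    ext ξ
    have h0 : pd i (fun _ => v z) ξ = 0 := by simp [pd]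
    rw [h0, smul_zero, add_zero, e, mul_smul, mul_smul, coordMul_apply]
  obtain ⟨-, h⟩ := contDiff_one_integral (μ := volume) (g := fun ξ z => osc z ξ • v z)
    (b := fun z => ‖v z‖ + ∑ i, ‖coordMul i v z‖)
    (fun ξ => ((contDiff_osc ξ).continuous.smul v.continuous).aestronglyMeasurable)
    (fun z => ((contDiff_osc' z).of_le (by simp)).smul contDiff_const)
    (fun ξ z => by
      rw [norm_smul, norm_osc, one_mul]
      exact le_add_of_nonneg_right (Finset.sum_nonneg fun i _ => norm_nonneg _))
    (fun i ξ z => by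
      rw [hpd, norm_smul, norm_osc, one_mul, norm_smul, Complex.norm_I, one_mul]
      exact (Finset.single_le_sum (f := fun i => ‖coordMul i v z‖)
        (fun i _ => norm_nonneg _) (Finset.mem_univ i)).trans
        (le_add_of_nonneg_left (norm_nonneg _)))
    (v.integrable.norm.add (integrable_finsetSum _ fun i _ => (coordMul i v).integrable.norm))
  rw [e, h]
  simp only [hpd]
  rw [schwartzOsc_apply, ← integral_smul]
  exact integral_congr_ae (ae_of_all _ fun z => smul_comm _ _ _)

lemma integrable_apply_schwartz {s : Rn n → X₀ →L[ℂ] X₁} (hs : s.HasTemperateGrowth)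
    (v : 𝓢(Rn n, X₀)) : Integrable fun ξ => s ξ (v ξ) :=
  (SchwartzMap.bilinLeftCLM (ContinuousLinearMap.apply ℂ X₁) hs v).integrable

/-- The counterpart of `coord_smul_oscInt` before any kernel exists. The decay of `schwartzOsc v`
alone ensures integrability, so `s` may grow polynomially. -/
lemma integral_apply_schwartzOsc_coordMul {s : Rn n → X₀ →L[ℂ] X₁} (hs : s.HasTemperateGrowth)
    (j : Fin n) (hs' : (pd j s).HasTemperateGrowth) (v : 𝓢(Rn n, X₀)) :
    ∫ ξ, s ξ (schwartzOsc (coordMul j v) ξ) =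
      ∫ ξ, (Complex.I • pd j s ξ) (schwartzOsc v ξ) := by
  have h1 : ∀ ξ, fderiv ℝ (schwartzOsc v) ξ (unitVec j) =
    Complex.I • schwartzOsc (coordMul j v) ξ := pd_schwartzOsc v j
  have key := integral_bilinear_fderiv_right_eq_neg_left_of_integrable (μ := volume)
    (f := s) (g := schwartzOsc v) (v := unitVec j)
    (B := (ContinuousLinearMap.id ℂ (X₀ →L[ℂ] X₁)).bilinearRestrictScalars ℝ)
    (integrable_apply_schwartz hs' (schwartzOsc v))
    (by
      simp only [h1]
      exact integrable_apply_schwartz hs (Complex.I • schwartzOsc (coordMul j v)))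
    (integrable_apply_schwartz hs (schwartzOsc v))
    (fun ξ _ => differentiable_of_smooth hs.1 ξ)
    (fun ξ _ => (schwartzOsc v).differentiable ξ)
  simp only [h1, ContinuousLinearMap.bilinearRestrictScalars_apply_apply,
    ContinuousLinearMap.id_apply, map_smul] at key
  rw [integral_smul] at key
  have h2 : ∫ ξ, (Complex.I • pd j s ξ) (schwartzOsc v ξ) =
      Complex.I • ∫ ξ, fderiv ℝ s ξ (unitVec j) (schwartzOsc v ξ) := by
    rw [← integral_smul]
    rfl
  rw [h2, ← neg_eq_iff_eq_neg.2 key, smul_neg, ← mul_smul, Complex.I_mul_I, neg_one_smul, neg_neg]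

/-- The function `z ↦ H(x, z) g(z)` as a Schwartz function. -/
def cutoffMul (H : Rn n → Rn n → ℂ) (x : Rn n) (g : 𝓢(Rn n, X₀)) : 𝓢(Rn n, X₀) :=
  SchwartzMap.smulLeftCLM X₀ (H x) g

lemma IsCutoff.cutoffMul_apply {H : Rn n → Rn n → ℂ} (h : IsCutoff k θ H) (x : Rn n)
    (g : 𝓢(Rn n, X₀)) (z : Rn n) : cutoffMul H x g z = H x z • g z :=
  SchwartzMap.smulLeftCLM_apply_apply (h.hasTemperateGrowth x) g z

/-- The function `z ↦ f(x - z)` as a Schwartz function. -/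
def reflect (x : Rn n) (f : 𝓢(Rn n, X₀)) : 𝓢(Rn n, X₀) :=
  SchwartzMap.compSubConstCLM ℂ x
    (SchwartzMap.compCLMOfContinuousLinearEquiv ℂ (ContinuousLinearEquiv.neg ℝ) f)

lemma reflect_apply (x : Rn n) (f : 𝓢(Rn n, X₀)) (z : Rn n) : reflect x f z = f (x - z) := by
  rw [reflect, SchwartzMap.compSubConstCLM_apply,
    SchwartzMap.compCLMOfContinuousLinearEquiv_apply]
  simp

lemma exp_smul_fourierHat (u : Rn n → X₀) (x ξ : Rn n) :
    Complex.exp (Complex.I * (inner ℝ x ξ : ℝ)) • fourierHat u ξ =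
      ∫ z, osc z ξ • u (x - z) := by
  rw [fourierHat, ← integral_smul]
  rw [← integral_sub_left_eq_self _ volume x]
  refine integral_congr_ae (ae_of_all _ fun z => ?_)
  simp only [smul_smul, osc, ← Complex.exp_add, inner_sub_left]
  congr 2
  push_cast
  ring

variable [CompleteSpace X₀] [CompleteSpace X₁]

/-- Fubini, with majorant `C ⟨ξ⟩^m ‖H(x, z) g(z)‖`, integrable on the product because `m < -n`. -/
lemma integral_apply_schwartzOsc_cutoffMul_of_lt {H : Rn n → Rn n → ℂ} (hH : IsCutoff k θ H)
    {p : Rn n → Rn n → X₀ →L[ℂ] X₁} (hp : Symb k θ m p) (hm : m < -n) (x : Rn n)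
    (g : 𝓢(Rn n, X₀)) :
    ∫ ξ, p x ξ (schwartzOsc (cutoffMul H x g) ξ) = ∫ z, (H x z • oscInt p x z) (g z) := by
  obtain ⟨C, hC, hb⟩ := hp.bound
  have e1 : ∀ ξ, p x ξ (schwartzOsc (cutoffMul H x g) ξ) =
      ∫ z, p x ξ (osc z ξ • cutoffMul H x g z) := fun ξ => by
    rw [schwartzOsc_apply]
    exact ((p x ξ).integral_comp_comm (integrable_osc_schwartz _ ξ)).symm
  have e2 : ∀ z, (H x z • oscInt p x z) (g z) =
      ∫ ξ, p x ξ (osc z ξ • cutoffMul H x g z) := fun z => by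
    rw [smul_apply, oscInt,
      ContinuousLinearMap.integral_apply (hp.integrable_osc_smul hm x z), ← integral_smul]
    refine integral_congr_ae (ae_of_all _ fun ξ => ?_)
    simp only [smul_apply, map_smul, hH.cutoffMul_apply]
    rw [smul_comm]
  simp only [e1, e2]
  refine integral_integral_swap (f := fun ξ z => p x ξ (osc z ξ • cutoffMul H x g z)) ?_
  have hint := (((integrable_japaneseBracket hm).const_mul C).mul_prod
    ((cutoffMul H x g).integrable (μ := volume)).norm)
  refine hint.mono' ?_ (ae_of_all _ fun q => ?_)
  · have h1 : Continuous fun q : Rn n × Rn n => p x q.1 := (hp.continuous x).comp continuous_fst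
    have h2 : Continuous fun q : Rn n × Rn n => osc q.2 q.1 := continuous_osc.comp continuous_swap
    have h3 : Continuous fun q : Rn n × Rn n => cutoffMul H x g q.2 :=
      (cutoffMul H x g).continuous.comp continuous_snd
    exact (h1.clm_apply (h2.smul h3)).aestronglyMeasurable
  · refine ((p x q.1).le_opNorm _).trans ?_
    rw [norm_smul, norm_osc, one_mul]
    exact mul_le_mul_of_nonneg_right ((hb q.1).bound x) (norm_nonneg _)

/-- Each induction step divides `H` by Hadamard's formula and integrates by parts, mirroring the
recursion of `kern`. -/
lemma integral_apply_schwartzOsc_cutoffMul (hθ0 : 0 ≤ θ) (hθ1 : θ ≤ 1) {H : Rn n → Rn n → ℂ}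
    (hH : IsCutoff k θ H) {p : Rn n → Rn n → X₀ →L[ℂ] X₁} (hp : Symb k θ m p) (N : ℕ)
    (hm : m < -n + N) (x : Rn n) (g : 𝓢(Rn n, X₀)) :
    ∫ ξ, p x ξ (schwartzOsc (cutoffMul H x g) ξ) = ∫ z, kern N H p x z (g z) := by
  induction N generalizing H p m with
  | zero => exact integral_apply_schwartzOsc_cutoffMul_of_lt hH hp (by simpa using hm) x g
  | succ N ih =>
    push_cast at hm
    have hp' : ∀ j, Symb k θ (m - 1) (fun x ξ => Complex.I • pd j (p x) ξ) := fun j =>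
      (hp.pd j).const_smul Complex.I
    have e : ∀ ξ, schwartzOsc (cutoffMul H x g) ξ =
        ∑ j, schwartzOsc (coordMul j (cutoffMul (hadamard j H) x g)) ξ := fun ξ => by
      simp only [schwartzOsc_apply]
      rw [← integral_finsetSum _ fun j _ => integrable_osc_schwartz _ ξ]
      refine integral_congr_ae (ae_of_all _ fun z => ?_)
      simp only [coordMul_apply]
      rw [hH.cutoffMul_apply, hH.eq_sum_hadamard x z, Finset.sum_smul, Finset.smul_sum]
      refine Finset.sum_congr rfl fun j _ => ?_
      rw [(hH.hadamard j).cutoffMul_apply, smul_assoc]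
    -- Splitting the integral of the sum requires each summand to be integrable: the kernels are
    -- bounded (`good_kern` with `L = 0`) and `g` is Schwartz.
    have hint : ∀ j, Integrable fun z =>
        kern N (hadamard j H) (fun x ξ => Complex.I • pd j (p x) ξ) x z (g z) := fun j => by
      have hgood := good_kern (L := 0) hθ0 hθ1 (hH.hadamard j) (hp' j) N
        (by push_cast; linarith)
      obtain ⟨C, hC⟩ := hgood.bound
      refine (g.integrable.norm.const_mul C).mono'
        ((hgood.1 x).clm_apply g.continuous).aestronglyMeasurable (ae_of_all _ fun z => ?_)
      exact (ContinuousLinearMap.le_opNorm _ _).trans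
        (mul_le_mul_of_nonneg_right ((hC z).bound x) (norm_nonneg _))
    simp only [e, map_sum, kern, sum_apply]
    rw [integral_finsetSum _ fun j _ => hint j,
      integral_finsetSum _ fun j _ => integrable_apply_schwartz (hp.hasTemperateGrowth x) _]
    refine Finset.sum_congr rfl fun j _ => ?_
    rw [integral_apply_schwartzOsc_coordMul (hp.hasTemperateGrowth x) j
      ((hp.pd j).hasTemperateGrowth x)]
    exact ih (hH.hadamard j) (hp' j) (by linarith)

/-- After `y = x - z` the phase becomes `e^{i z·ξ}` and `f` becomes `f(x - z)`. With `x` fixed,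
`φ(x)`, `ψ(x - z)` and `(2π)^{-n}` all enter through `H`. -/
lemma localizedOp_eq (hθ0 : 0 ≤ θ) (hθ1 : θ ≤ 1) {φ ψ : Rn n → ℂ}
    {p : Rn n → Rn n → X₀ →L[ℂ] X₁} (hp : Symb k θ m p) {H : Rn n → Rn n → ℂ}
    (hH : IsCutoff k θ H)
    (hHe : ∀ x z, H x z = ((((2 * Real.pi) ^ n)⁻¹ : ℝ) : ℂ) * (φ x * ψ (x - z)))
    (N : ℕ) (hm : m < -n + N) (f : 𝓢(Rn n, X₀)) (x : Rn n) :
    localizedOp φ p ψ f x = ∫ y, kern N H p x (x - y) (f y) := by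
  have h1 : ∫ y, kern N H p x (x - y) (f y) = ∫ z, kern N H p x z (reflect x f z) := by
    rw [← integral_sub_left_eq_self _ volume x]
    simp only [reflect_apply, sub_sub_cancel]
  rw [h1, ← integral_apply_schwartzOsc_cutoffMul hθ0 hθ1 hH hp N hm x (reflect x f),
    localizedOp, pseudoOp]
  have h2 : ∀ v : X₁, φ x • ((2 * Real.pi) ^ n)⁻¹ • v =
      (((((2 * Real.pi) ^ n)⁻¹ : ℝ) : ℂ) * φ x) • v := fun v => by
    rw [mul_comm (((((2 * Real.pi) ^ n)⁻¹ : ℝ) : ℂ)) (φ x), mul_smul]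
    rfl
  rw [h2, ← integral_smul]
  refine integral_congr_ae (ae_of_all _ fun ξ => ?_)
  have h3 : schwartzOsc (cutoffMul H x (reflect x f)) ξ =
      (((((2 * Real.pi) ^ n)⁻¹ : ℝ) : ℂ) * φ x) • ∫ z, osc z ξ • ψ (x - z) • f (x - z) := by
    rw [schwartzOsc_apply, ← integral_smul]
    refine integral_congr_ae (ae_of_all _ fun z => ?_)
    simp only [hH.cutoffMul_apply, reflect_apply, hHe, smul_smul]
    congr 1
    ring
  simp only [h3, ← map_smul]
  rw [← exp_smul_fourierHat (fun y => ψ y • f y)]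

end Representation

end

end NonsmoothPDO

/-! ### Conclusion. -/

open NonsmoothPDO in
theorem mainTheorem7 (n : ℕ)
    {X₀ X₁ : Type*} [NormedAddCommGroup X₀] [NormedSpace ℂ X₀] [CompleteSpace X₀]
    [NormedAddCommGroup X₁] [NormedSpace ℂ X₁] [CompleteSpace X₁]
    (τ m : ℝ) (hτ : 0 < τ)
    (φ ψ : NonsmoothPDO.Rn n → ℂ)
    (hφ : NonsmoothPDO.MemCbInfty φ) (hψ : NonsmoothPDO.MemCbInfty ψ)
    (hsupp : tsupport φ ∩ tsupport ψ = ∅)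
    (p : NonsmoothPDO.Rn n → NonsmoothPDO.Rn n → (X₀ →L[ℂ] X₁))
    (hp : NonsmoothPDO.IsCtauSymbol τ m p) :
    ∃ K : NonsmoothPDO.Rn n → NonsmoothPDO.Rn n → (X₀ →L[ℂ] X₁),
      NonsmoothPDO.IsCtauCinftyKernel τ (NonsmoothPDO.localizedOp φ p ψ) K := by
  have hθ0 : 0 ≤ τ - ⌊τ⌋₊ := sub_nonneg.2 (Nat.floor_le hτ.le)
  have hθ1 : τ - ⌊τ⌋₊ ≤ 1 := by linarith [Nat.lt_floor_add_one τ]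
  have hs := Symb.of_isCtauSymbol hp
  have hc := isCutoff_mul (k := ⌊τ⌋₊) hθ0 hθ1 hφ hψ hsupp
  have hH : IsCutoff ⌊τ⌋₊ (τ - ⌊τ⌋₊)
      (fun x z => ((((2 * Real.pi) ^ n)⁻¹ : ℝ) : ℂ) * (φ x * ψ (x - z))) :=
    ⟨hc.1.const_smul _, fun x => (hc.2 x).mono fun z hz => by simp [hz]⟩
  -- One fixed `N`, just large enough for convergence, serves for all derivatives and moments by
  -- `good_kern_all`.
  obtain ⟨N, hN⟩ := exists_nat_gt (m + n)
  have hm : m < -n + N := by linarith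
  have hgood := good_kern_all hθ0 hθ1 hH hs N hm
  exact ⟨_, localizedOp_eq hθ0 hθ1 hs hH (fun _ _ => rfl) N hm,
    fun x => contDiff_infty.2 fun L => (hgood L).contDiff x, Good.ctau hgood⟩
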